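/- Let $R$ be a left noetherian ring and $S$ a right noetherian ring. Let ${}_RU$ be a generalized tilting (Wakamatsu tilting) left $R$-module with $S=\operatorname{End}({}_RU)$ acting on $U$ from the right; that is: ${}_RU$ has a resolution by finitely generated projective left $R$-modules, $\operatorname{Ext}^i_R(U,U)=0$ for all $i\ge 1$, and there is an exact sequence $0\to R\to U_0\to U_1\to\cdots$ of left $R$-modules with every $U_i$ isomorphic to a direct summand of a finite direct sum of copies of $U$, which remains exact after applying $\operatorname{Hom}_R(-,U)$. Let $\operatorname{Add}_RU$ be the class of left $R$-modules isomorphic to direct summands of arbitrary direct sums of copies of $U$, and let $\operatorname{add-lim}_RU$ be the class of left $R$-modules isomorphic to direct summands of direct limits (over directed index sets) of modules each of which is a finite direct sum of copies of $U$. For a class $\mathcal X$ of left $R$-modules containing $0$ and a left $R$-module $A$, let $\mathcal X\text{-resol.dim}_R(A)$ be the infimum of all $m\ge 0$ for which there is an exact sequence $0\to T_m\to\cdots\to T_1\to T_0\to A\to 0$ with all $T_i\in\mathcal X$ (and $\infty$ if there is no such $m$); put $U\text{-lim.dim}_R(A)=(\operatorname{add-lim}_RU)\text{-resol.dim}_R(A)$.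 Let ${}_RQ$ be an injective cogenerator for the category of left $R$-modules, and let ${}^*Q=\operatorname{Hom}_R(U,Q)$, a left $S$-module via $(sf)(u)=f(us)$. Suppose that the injective dimension of ${}_RU$ is finite, say $\operatorname{l.id}_R(U)=n<\infty$. Then the following statements are equivalent. 1. The injective dimension of the right $S$-module $U_S$ is $\operatorname{r.id}_S(U)=n$. 2. At least one of the following is finite: the flat dimension $\operatorname{l.fd}_S({}^*Q)$, the projective dimension $\operatorname{l.pd}_S({}^*Q)$, $U\text{-lim.dim}_R(Q)$, $\operatorname{Add}_RU\text{-resol.dim}_R(Q)$. -/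

import Mathlib

open CategoryTheory
open scoped TensorProduct

universe u

namespace GenTilt

/-! ### Resolutions and the dimension relative to a class of modules

Left `R`-modules are objects of `ModuleCat R`, right `S`-modules are modules over `Sᵐᵒᵖ`. -/

section Resolutions

variable {R : Type u} [Ring R]

/-- An exact sequence `⋯ → X 2 → X 1 → X 0 → A → 0` of left `R`-modules. -/
structure LeftResolution (A : ModuleCat.{u} R) where
  X : ℕ → ModuleCat.{u} R
  d : ∀ i, X (i + 1) →ₗ[R] X i
  ε : X 0 →ₗ[R] A
  surjective : Function.Surjective ε
  exact_zero : Function.Exact (d 0) ε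
  exact_succ : ∀ i, Function.Exact (d (i + 1)) (d i)

/-- There is an exact sequence `0 → X n → ⋯ → X 1 → X 0 → A → 0` with all `X i` in `P`
(it is extended by `X i = 0` for `i > n`). -/
def HasResolutionOfLength (P : ModuleCat.{u} R → Prop) (A : ModuleCat.{u} R) (n : ℕ) : Prop :=
  ∃ T : LeftResolution A, (∀ i ≤ n, P (T.X i)) ∧ ∀ i, n < i → Subsingleton (T.X i)

/-- The resolution dimension of `A` relative to the class `P`: the infimum of the lengths of the
finite resolutions of `A` by modules in `P`, and `⊤` if there are none.
(For a class containing the zero module, a finite resolution extends by zeros to an infinite one,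
so a finite value presupposes nothing else.) -/
noncomputable def resolDim (P : ModuleCat.{u} R → Prop) (A : ModuleCat.{u} R) : ℕ∞ :=
  ⨅ (n : ℕ) (_ : HasResolutionOfLength P A n), (n : ℕ∞)

end Resolutions

/-! ### The classes `add U`, `Add U` and `add-lim U` -/

section Classes

variable (R : Type u) [Ring R] (U : Type u) [AddCommGroup U] [Module R U]

/-- `M` is isomorphic to a direct summand of `N`. -/
def IsSummand (M N : Type u) [AddCommGroup M] [Module R M] [AddCommGroup N] [Module R N] : Prop :=
  ∃ Z : ModuleCat.{u} R, Nonempty ((M × Z) ≃ₗ[R] N)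

/-- `add U`: direct summands of finite direct sums of copies of `U`. -/
def MemAdd (M : ModuleCat.{u} R) : Prop :=
  ∃ k : ℕ, IsSummand R M (Fin k → U)

/-- `Add U`: direct summands of arbitrary direct sums of copies of `U`. -/
def MemBigAdd (M : ModuleCat.{u} R) : Prop :=
  ∃ I : Type u, IsSummand R M (I →₀ U)

open Classical in
/-- `add-lim U`: direct summands of direct limits (over directed index sets) of modules each of
which is a finite direct sum of copies of `U`. -/
def MemAddLim (M : ModuleCat.{u} R) : Prop :=
  ∃ (ι : Type u) (_ : Preorder ι) (_ : IsDirectedOrder ι) (_ : Nonempty ι)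
    (G : ι → ModuleCat.{u} R) (f : ∀ i j, i ≤ j → G i →ₗ[R] G j)
    (_ : DirectedSystem (fun i => G i) fun i j h => f i j h),
    (∀ i, ∃ k : ℕ, Nonempty (G i ≃ₗ[R] (Fin k → U))) ∧
      IsSummand R M (Module.DirectLimit (fun i => G i) f)

/-- The `U`-limit dimension of `A`. -/
noncomputable def limDim (A : ModuleCat.{u} R) : ℕ∞ :=
  resolDim (MemAddLim R U) A

/-- The `Add U`-resolution dimension of `A`. -/
noncomputable def addResolDim (A : ModuleCat.{u} R) : ℕ∞ :=
  resolDim (MemBigAdd R U) A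

end Classes

/-! ### Generalized (Wakamatsu) tilting modules -/

section Tilting

variable (R : Type u) [Ring R] (U : Type u) [AddCommGroup U] [Module R U]

/-- `A` has a resolution `⋯ → P 1 → P 0 → A → 0` by finitely generated projective modules. -/
def MemGenStar (A : ModuleCat.{u} R) : Prop :=
  ∃ T : LeftResolution A, ∀ i, Module.Finite R (T.X i) ∧ Module.Projective R (T.X i)

/-- `Extⁱ_R(U, U) = 0` for all `i ≥ 1`. -/
def IsSelforthogonal : Prop :=
  ∀ i : ℕ, 1 ≤ i → Subsingleton (Abelian.Ext (ModuleCat.of R U) (ModuleCat.of R U) i)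

/-- An exact sequence `0 → R → U₀ → U₁ → ⋯` with all `Uᵢ` in `add U`, which stays exact under
`Hom_R(-, U)`, i.e. such that `⋯ → Hom(U₁, U) → Hom(U₀, U) → Hom(R, U) → 0` is exact. -/
structure AddCoresolution where
  X : ℕ → ModuleCat.{u} R
  η : R →ₗ[R] X 0
  d : ∀ i, X i →ₗ[R] X (i + 1)
  mem : ∀ i, MemAdd R U (X i)
  injective : Function.Injective η
  exact_zero : Function.Exact η (d 0)
  exact_succ : ∀ i, Function.Exact (d i) (d (i + 1))
  hom_surjective : Function.Surjective fun g : X 0 →ₗ[R] U => g ∘ₗ η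
  hom_exact_zero : Function.Exact (fun g : X 1 →ₗ[R] U => g ∘ₗ d 0)
    (fun g : X 0 →ₗ[R] U => g ∘ₗ η)
  hom_exact_succ : ∀ i, Function.Exact (fun g : X (i + 2) →ₗ[R] U => g ∘ₗ d (i + 1))
    (fun g : X (i + 1) →ₗ[R] U => g ∘ₗ d i)

/-- `U` is a generalized tilting left `R`-module. -/
structure IsGeneralizedTilting : Prop where
  genStar : MemGenStar R (ModuleCat.of R U)
  selforthogonal : IsSelforthogonal R U
  coresolution : Nonempty (AddCoresolution R U)

/-- `S = End(_R U)`, acting on `U` from the right: the natural ring homomorphism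
`Sᵐᵒᵖ → End_R(U)` is bijective. -/
def IsEndRing (S : Type u) [Ring S] [Module Sᵐᵒᵖ U] [SMulCommClass Sᵐᵒᵖ R U] : Prop :=
  Function.Bijective (Module.toModuleEnd R (S := Sᵐᵒᵖ) U)

end Tilting

/-! ### Flat dimension over a noncommutative ring -/

section Flat

variable (S : Type u) [Ring S]

/-- The subgroup of `N ⊗[ℤ] M` generated by the elements `(n s) ⊗ m - n ⊗ (s m)`. -/
def balancingSubgroup (N M : Type u) [AddCommGroup N] [Module Sᵐᵒᵖ N] [AddCommGroup M]
    [Module S M] : AddSubgroup (N ⊗[ℤ] M) :=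
  AddSubgroup.closure {t | ∃ (n : N) (s : S) (m : M),
    t = (MulOpposite.op s • n) ⊗ₜ[ℤ] m - n ⊗ₜ[ℤ] (s • m)}

/-- The tensor product `N ⊗_S M` of a right and a left `S`-module. -/
abbrev BalancedTensor (N M : Type u) [AddCommGroup N] [Module Sᵐᵒᵖ N] [AddCommGroup M]
    [Module S M] : Type u :=
  (N ⊗[ℤ] M) ⧸ balancingSubgroup S N M

/-- The map `φ ⊗ M : N ⊗_S M → N' ⊗_S M` induced by `φ : N → N'`. -/
def BalancedTensor.map {N N' : Type u} [AddCommGroup N] [Module Sᵐᵒᵖ N] [AddCommGroup N']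
    [Module Sᵐᵒᵖ N'] (φ : N →ₗ[Sᵐᵒᵖ] N') (M : Type u) [AddCommGroup M] [Module S M] :
    BalancedTensor S N M →+ BalancedTensor S N' M :=
  QuotientAddGroup.map (balancingSubgroup S N M) (balancingSubgroup S N' M)
    (TensorProduct.map φ.toAddMonoidHom.toIntLinearMap (LinearMap.id (R := ℤ) (M := M))).toAddMonoidHom
    (by
      rw [balancingSubgroup, AddSubgroup.closure_le]
      rintro _ ⟨n, s, m, rfl⟩
      refine AddSubgroup.subset_closure ⟨φ n, s, m, ?_⟩
      simp)

/-- `M` is a flat left `S`-module: `- ⊗_S M` preserves injections of right `S`-modules. -/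
def IsFlat (M : ModuleCat.{u} S) : Prop :=
  ∀ (N N' : ModuleCat.{u} Sᵐᵒᵖ) (φ : N →ₗ[Sᵐᵒᵖ] N'), Function.Injective φ →
    Function.Injective (BalancedTensor.map S φ M)

/-- The flat dimension of a left `S`-module. -/
noncomputable def flatDim (M : ModuleCat.{u} S) : ℕ∞ :=
  resolDim (IsFlat S) M

end Flat

/-! ### The left `S`-module `*Q = Hom_R(U, Q)` -/

section Star

variable (R S : Type u) [Ring R] [Ring S] (U Q : Type u) [AddCommGroup U] [AddCommGroup Q]
  [Module R U] [Module Sᵐᵒᵖ U] [SMulCommClass Sᵐᵒᵖ R U] [Module R Q]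

/-- The left `S`-module structure `(s f)(x) = f (x s)` on `Hom_R(U, Q)`. -/
@[reducible] def starModule : Module S (U →ₗ[R] Q) where
  smul s f := f ∘ₗ Module.toModuleEnd R U (MulOpposite.op s)
  one_smul f := LinearMap.ext fun x => congrArg f (one_smul Sᵐᵒᵖ x)
  mul_smul s t f := LinearMap.ext fun x =>
    congrArg f (mul_smul (MulOpposite.op t) (MulOpposite.op s) x)
  smul_zero _ := LinearMap.ext fun _ => rfl
  smul_add _ _ _ := LinearMap.ext fun _ => rfl
  add_smul s t f := LinearMap.ext fun x =>
    (congrArg f (add_smul (MulOpposite.op s) (MulOpposite.op t) x)).trans (map_add f _ _)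
  zero_smul f := LinearMap.ext fun x => (congrArg f (zero_smul Sᵐᵒᵖ x)).trans (map_zero f)

/-- `*Q = Hom_R(U, Q)` as a left `S`-module. -/
def star : ModuleCat.{u} S :=
  letI := starModule R S U Q
  ModuleCat.of S (U →ₗ[R] Q)

end Star

end GenTilt

/-! Put `A = R` and `B = Sᵐᵒᵖ`, so `B = End_A(U)`, and let `F` run over the exact sequences of
finite free `B`-modules. Since `B` is noetherian, `Coacyclic B U m` (exactness of `Hom_B(F, U)` in
degree `m + 1`) means `r.id_S(U) ≤ m`. Since `Hom_A(Hom_B(F, U), N) = F ⊗_S Hom_A(U, N)`, `Acyclic A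
B U N m` means that `Hom_A(U, N)` has flat dimension at most `m` over `S`. An injective cogenerator
preserves and reflects exactness, so `l.fd_S(*Q)` and `r.id_S(U)` have the same finite bounds `m`
(`Coacyclic.acyclic`, `Acyclic.coacyclic`, `acyclic_star_iff`, `flatDim_ne_top_iff`).

Each of the other three dimensions, if finite, bounds this flat dimension. Projectives are flat.
Modules in `Add U` and `add-lim U` are locally finite powers of `U` (`LocAdd`); for such modules
`Hom_A(U, -)` is flat and `Ext_A^i(U, -) = 0` for `i ≥ 1`, so finite resolutions by them stay exact
under `Hom_A(U, -)` (`acyclic_of_hasResolutionOfLength_locAdd`). Hence condition 2 says that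
`r.id_S(U)` is finite.

It remains that two finite injective dimensions agree (`coacyclic_iff_of_finite`). Let `id_A(U) ≤ m`
and `id_B(U) ≤ m + 1`, and let `Q` be an injective cogenerator over `A`. Cover `Q` repeatedly by
direct sums of copies of `U`, with syzygies `L 0 = Q, L 1, L 2, …`. Then `Hom_A(U, L (m+1))` is
flat, so `L (m+1)` is locally a power of `U`; thus its injective dimension is at most `m` and
`Ext_A^i(U, L (m+1)) = 0`. Dimension shifting gives `Ext¹(L m, L (m+1)) = Ext^(m+1)(Q, L (m+1)) =
0`, the last cover splits, `L m` lies in `Add U`, and `id_B(U) ≤ m` (`acyclic_pred_of_injective`).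
Descending gives `id_B(U) ≤ id_A(U)`. The hypotheses on `U` are symmetric under `Hom_A(-, U)`
(`AddCoresolution.dual`, `LeftResolution.dual`), which gives the other inequality. -/

namespace GenTilt

/-! ### Exactness after applying `Hom(-, N)` -/

section HomExact

variable {A : Type u} [Ring A]

/-- For `X → Y → Z`, every map `Y → N` that vanishes on `X` extends along `Y → Z`. -/
def HomExact {X Y Z : Type u} [AddCommGroup X] [AddCommGroup Y] [AddCommGroup Z]
    [Module A X] [Module A Y] [Module A Z] (a : X →ₗ[A] Y) (b : Y →ₗ[A] Z)
    (N : Type u) [AddCommGroup N] [Module A N] : Prop :=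
  ∀ f : Y →ₗ[A] N, f ∘ₗ a = 0 → ∃ g : Z →ₗ[A] N, g ∘ₗ b = f

/-- Every map from `Y` lifts along `π`. -/
def HasLifts {T N : Type u} [AddCommGroup T] [AddCommGroup N] [Module A T] [Module A N]
    (π : T →ₗ[A] N) (Y : Type u) [AddCommGroup Y] [Module A Y] : Prop :=
  ∀ f : Y →ₗ[A] N, ∃ g : Y →ₗ[A] T, π ∘ₗ g = f

/-! ### Long exact sequences for a short exact sequence of coefficients -/

section ShortExact

variable {K T N : Type u} [AddCommGroup K] [AddCommGroup T] [AddCommGroup N]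
  [Module A K] [Module A T] [Module A N] {ι : K →ₗ[A] T} {π : T →ₗ[A] N}

theorem exists_comp_eq_of_exact (hι : Function.Injective ι) (h : Function.Exact ι π)
    {Y : Type u} [AddCommGroup Y] [Module A Y] (f : Y →ₗ[A] T) (hf : π ∘ₗ f = 0) :
    ∃ k : Y →ₗ[A] K, ι ∘ₗ k = f := by
  have hmem : ∀ y, f y ∈ LinearMap.range ι := fun y =>
    (h (f y)).1 (LinearMap.congr_fun hf y)
  refine ⟨(LinearEquiv.ofInjective ι hι).symm.toLinearMap ∘ₗ f.codRestrict _ hmem, ?_⟩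
  ext y
  have := (LinearEquiv.ofInjective ι hι).apply_symm_apply (f.codRestrict _ hmem y)
  exact congrArg Subtype.val this

theorem exists_desc_of_exact (hπ : Function.Surjective π) (h : Function.Exact ι π)
    {M : Type u} [AddCommGroup M] [Module A M] (f : T →ₗ[A] M) (hf : f ∘ₗ ι = 0) :
    ∃ g : N →ₗ[A] M, g ∘ₗ π = f := by
  have hle : LinearMap.ker π ≤ LinearMap.ker f := by
    intro x hx
    obtain ⟨y, rfl⟩ := (h x).1 hx
    exact LinearMap.congr_fun hf y
  refine ⟨(LinearMap.ker π).liftQ f hle ∘ₗ (π.quotKerEquivOfSurjective hπ).symm.toLinearMap, ?_⟩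
  ext x
  have : (π.quotKerEquivOfSurjective hπ).symm (π x) = (LinearMap.ker π).mkQ x := by
    rw [LinearEquiv.symm_apply_eq]; rfl
  simp [this]

variable {X' X Y Z Z' : Type u} [AddCommGroup X'] [AddCommGroup X] [AddCommGroup Y]
  [AddCommGroup Z] [AddCommGroup Z'] [Module A X'] [Module A X] [Module A Y] [Module A Z]
  [Module A Z']

/-- A piece of the long cohomology sequence, by a direct chase. Lifting along `π` is needed at the
single term `Z'`, not in every degree. -/
theorem HomExact.left_of_shortExact (hι : Function.Injective ι) (h : Function.Exact ι π)
    {a : X →ₗ[A] Y} {b : Y →ₗ[A] Z} {c : Z →ₗ[A] Z'} (hcb : c ∘ₗ b = 0)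
    (hT : HomExact a b T) (hN : HomExact b c N) (hl : HasLifts π Z') : HomExact a b K := by
  intro f hf
  obtain ⟨g, hg⟩ := hT (ι ∘ₗ f) (by rw [LinearMap.comp_assoc, hf, LinearMap.comp_zero])
  -- Subtracting a lift of this extension, composed with `c`, moves `g` into `K` and does not change
  -- `g ∘ b`, as `c ∘ b = 0`.
  obtain ⟨p, hp⟩ := hN (π ∘ₗ g) (by
    rw [LinearMap.comp_assoc, hg, ← LinearMap.comp_assoc, h.linearMap_comp_eq_zero,
      LinearMap.zero_comp])
  obtain ⟨q, hq⟩ := hl p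
  obtain ⟨k, hk⟩ := exists_comp_eq_of_exact hι h (g - q ∘ₗ c) (by
    rw [LinearMap.comp_sub, ← LinearMap.comp_assoc, hq, hp, sub_self])
  refine ⟨k, ?_⟩
  ext y
  apply hι
  have h1 := LinearMap.congr_fun hk (b y)
  have h2 := LinearMap.congr_fun hg y
  have h3 := LinearMap.congr_fun hcb y
  simp only [LinearMap.comp_apply, LinearMap.sub_apply, LinearMap.zero_apply] at h1 h2 h3 ⊢
  rw [h1, h2, h3, map_zero, sub_zero]

/-- The obstruction to extending a lift of `f` is a cocycle with values in `K`, which can be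
subtracted. The factorisation through `T` is kept because `LeftResolution.IsHomAcyclic.hasLifts`
needs it. -/
theorem HomExact.exists_lift_of_shortExact (hι : Function.Injective ι)
    (h : Function.Exact ι π)
    {a' : X' →ₗ[A] X} {a : X →ₗ[A] Y} {b : Y →ₗ[A] Z} (haa : a ∘ₗ a' = 0)
    (hK : HomExact a' a K) (hT : HomExact a b T) (hl : HasLifts π Y)
    (f : Y →ₗ[A] N) (hf : f ∘ₗ a = 0) : ∃ g : Z →ₗ[A] T, π ∘ₗ g ∘ₗ b = f := by
  obtain ⟨f', hf'⟩ := hl f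
  obtain ⟨k, hk⟩ := exists_comp_eq_of_exact hι h (f' ∘ₗ a) (by
    rw [← LinearMap.comp_assoc, hf', hf])
  obtain ⟨k', hk'⟩ := hK k (by
    ext x
    apply hι
    have h1 := LinearMap.congr_fun hk (a' x)
    have h2 := LinearMap.congr_fun haa x
    simp only [LinearMap.comp_apply, LinearMap.zero_apply] at h1 h2 ⊢
    rw [h1, h2, map_zero, map_zero])
  obtain ⟨g, hg⟩ := hT (f' - ι ∘ₗ k') (by
    rw [LinearMap.sub_comp, LinearMap.comp_assoc, hk', hk, sub_self])
  refine ⟨g, ?_⟩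
  rw [hg, LinearMap.comp_sub, hf', ← LinearMap.comp_assoc, h.linearMap_comp_eq_zero,
    LinearMap.zero_comp, sub_zero]

theorem HomExact.right_of_shortExact (hι : Function.Injective ι)
    (h : Function.Exact ι π)
    {a' : X' →ₗ[A] X} {a : X →ₗ[A] Y} {b : Y →ₗ[A] Z} (haa : a ∘ₗ a' = 0)
    (hK : HomExact a' a K) (hT : HomExact a b T) (hl : HasLifts π Y) : HomExact a b N := by
  intro f hf
  obtain ⟨g, hg⟩ := HomExact.exists_lift_of_shortExact hι h haa hK hT hl f hf
  exact ⟨π ∘ₗ g, by rw [LinearMap.comp_assoc, hg]⟩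

theorem HomExact.of_retract {a : X →ₗ[A] Y} {b : Y →ₗ[A] Z} (hT : HomExact a b T)
    (i : N →ₗ[A] T) (r : T →ₗ[A] N) (hr : r ∘ₗ i = LinearMap.id) : HomExact a b N := by
  intro f hf
  obtain ⟨g, hg⟩ := hT (i ∘ₗ f) (by rw [LinearMap.comp_assoc, hf, LinearMap.comp_zero])
  exact ⟨r ∘ₗ g, by rw [LinearMap.comp_assoc, hg, ← LinearMap.comp_assoc, hr, LinearMap.id_comp]⟩

theorem HomExact.pi {a : X →ₗ[A] Y} {b : Y →ₗ[A] Z} (hN : HomExact a b N) {k : ℕ} :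
    HomExact a b (Fin k → N) := by
  intro f hf
  choose g hg using fun j => hN (LinearMap.proj j ∘ₗ f) (by
    rw [LinearMap.comp_assoc, hf, LinearMap.comp_zero])
  refine ⟨LinearMap.pi g, ?_⟩
  ext y j
  exact LinearMap.congr_fun (hg j) y

theorem HasLifts.pi (hl : HasLifts π Y) {k : ℕ} : HasLifts π (Fin k → Y) := by
  intro f
  choose g hg using fun j => hl (f ∘ₗ LinearMap.single A (fun _ => Y) j)
  refine ⟨∑ j, g j ∘ₗ LinearMap.proj j, ?_⟩
  refine LinearMap.pi_ext' fun i => ?_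
  rw [← hg i]
  ext y
  simp [Pi.single_apply, Finset.sum_ite_eq', apply_ite]

theorem HasLifts.of_retract (hl : HasLifts π Y) (i : X →ₗ[A] Y) (r : Y →ₗ[A] X)
    (hr : r ∘ₗ i = LinearMap.id) : HasLifts π X := by
  intro f
  obtain ⟨g, hg⟩ := hl (f ∘ₗ r)
  exact ⟨g ∘ₗ i, by rw [← LinearMap.comp_assoc, hg, LinearMap.comp_assoc, hr, LinearMap.comp_id]⟩

theorem HasLifts.of_surjective (hπ : Function.Surjective π) [Module.Projective A Y] :
    HasLifts π Y :=
  fun f => Module.projective_lifting_property π f hπ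

end ShortExact

end HomExact

/-! ### Retracts of finite powers -/

section RetractPow

variable (A : Type u) [Ring A] (U : Type u) [AddCommGroup U] [Module A U]

/-- `W` is a retract of a finite power of `U`. -/
def RetractPow (W : Type u) [AddCommGroup W] [Module A W] : Prop :=
  ∃ (k : ℕ) (i : W →ₗ[A] (Fin k → U)) (r : (Fin k → U) →ₗ[A] W), r ∘ₗ i = LinearMap.id

variable {A U}

theorem retractPow_pi (k : ℕ) : RetractPow A U (Fin k → U) :=
  ⟨k, LinearMap.id, LinearMap.id, rfl⟩

theorem retractPow_of_isSummand {W : Type u} [AddCommGroup W] [Module A W] {k : ℕ}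
    (h : IsSummand A W (Fin k → U)) : RetractPow A U W := by
  obtain ⟨Z, ⟨e⟩⟩ := h
  refine ⟨k, e.toLinearMap ∘ₗ LinearMap.inl A W Z, LinearMap.fst A W Z ∘ₗ e.symm.toLinearMap, ?_⟩
  ext x
  simp

theorem isSummand_of_retract {W V : Type u} [AddCommGroup W] [Module A W] [AddCommGroup V]
    [Module A V] (i : W →ₗ[A] V) (r : V →ₗ[A] W) (h : r ∘ₗ i = LinearMap.id) :
    IsSummand A W V := by
  have hr : ∀ x, r (i x) = x := LinearMap.congr_fun h
  refine ⟨ModuleCat.of A (LinearMap.ker r), ⟨?_⟩⟩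
  refine LinearEquiv.ofBijective (i.coprod (LinearMap.ker r).subtype) ⟨?_, ?_⟩
  · rw [← LinearMap.ker_eq_bot, LinearMap.ker_eq_bot']
    rintro ⟨x, y, hy⟩ hxy
    simp only [LinearMap.coprod_apply, Submodule.subtype_apply] at hxy
    have h1 : x = 0 := by
      have := congrArg r hxy
      rw [map_add, hr, LinearMap.mem_ker.1 hy, add_zero, map_zero] at this
      exact this
    subst h1
    simp only [map_zero, zero_add] at hxy
    subst hxy
    rfl
  · intro v
    refine ⟨(r v, ⟨v - i (r v), by simp [hr]⟩), ?_⟩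
    simp

theorem retractPow_self_of_projective (P : Type u) [AddCommGroup P] [Module A P]
    [Module.Finite A P] [Module.Projective A P] : RetractPow A A P := by
  obtain ⟨n, f, hf⟩ := Module.Finite.exists_fin' A P
  obtain ⟨g, hg⟩ := Module.projective_lifting_property f LinearMap.id hf
  exact ⟨n, g, f, hg⟩

theorem RetractPow.finite {W : Type u} [AddCommGroup W] [Module A W] (h : RetractPow A U W)
    [Module.Finite A U] : Module.Finite A W := by
  obtain ⟨k, i, r, hr⟩ := h
  exact Module.Finite.of_surjective r fun x => ⟨i x, LinearMap.congr_fun hr x⟩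

theorem RetractPow.projective {P : Type u} [AddCommGroup P] [Module A P] (h : RetractPow A A P) :
    Module.Projective A P := by
  obtain ⟨k, i, r, hr⟩ := h
  exact Module.Projective.of_split i r hr

theorem RetractPow.hasLifts {T N W : Type u} [AddCommGroup T] [AddCommGroup N] [Module A T]
    [Module A N] [AddCommGroup W] [Module A W] {π : T →ₗ[A] N} (h : RetractPow A U W)
    (hl : HasLifts π U) : HasLifts π W := by
  obtain ⟨k, i, r, hr⟩ := h
  exact hl.pi.of_retract i r hr

variable (A U) in
/-- The direct sum of two finite powers is a finite power. -/
def powProdEquiv (k l : ℕ) : ((Fin k → U) × (Fin l → U)) ≃ₗ[A] (Fin (k + l) → U) :=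
  (LinearEquiv.sumArrowLequivProdArrow (Fin k) (Fin l) A U).symm.trans
    (LinearEquiv.funCongrLeft A U finSumFinEquiv.symm)

end RetractPow

/-! ### Modules that are locally finite powers of `U` -/

section LocAdd

variable (A : Type u) [Ring A] (U : Type u) [AddCommGroup U] [Module A U]

/-- `C` is locally a finite power of `U`: its elements come from maps `U ^ k → C`, and so do the
relations between them. -/
structure LocAdd (C : Type u) [AddCommGroup C] [Module A C] : Prop where
  cover : ∀ c : C, ∃ (k : ℕ) (g : (Fin k → U) →ₗ[A] C) (w : Fin k → U), g w = c
  kill : ∀ (k : ℕ) (f : (Fin k → U) →ₗ[A] C) (w : Fin k → U), f w = 0 →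
    ∃ (l : ℕ) (b : (Fin k → U) →ₗ[A] (Fin l → U)) (g : (Fin l → U) →ₗ[A] C),
      g ∘ₗ b = f ∧ b w = 0

variable {A U} {C : Type u} [AddCommGroup C] [Module A C]

theorem LocAdd.of_retract {D : Type u} [AddCommGroup D] [Module A D] (h : LocAdd A U C)
    (i : D →ₗ[A] C) (r : C →ₗ[A] D) (hr : r ∘ₗ i = LinearMap.id) : LocAdd A U D where
  cover d := by
    obtain ⟨k, g, w, hw⟩ := h.cover (i d)
    exact ⟨k, r ∘ₗ g, w, by rw [LinearMap.comp_apply, hw]; exact LinearMap.congr_fun hr d⟩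
  kill k f w hf := by
    obtain ⟨l, b, g, hg, hb⟩ := h.kill k (i ∘ₗ f) w (by rw [LinearMap.comp_apply, hf, map_zero])
    exact ⟨l, b, r ∘ₗ g, by
      rw [LinearMap.comp_assoc, hg, ← LinearMap.comp_assoc, hr, LinearMap.id_comp], hb⟩

theorem LocAdd.exists_cover (h : LocAdd A U C) : ∀ (n : ℕ) (c : Fin n → C),
    ∃ (k : ℕ) (g : (Fin k → U) →ₗ[A] C) (w : Fin n → Fin k → U), ∀ i, g (w i) = c i
  | 0, _ => ⟨0, 0, fun _ => 0, fun i => i.elim0⟩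
  | n + 1, c => by
    obtain ⟨k, g, w, hw⟩ := LocAdd.exists_cover h n (Fin.tail c)
    obtain ⟨l, g', w', hw'⟩ := h.cover (c 0)
    let e := powProdEquiv A U k l
    refine ⟨k + l, g.coprod g' ∘ₗ e.symm.toLinearMap,
      Fin.cons (e (0, w')) fun i => e (w i, 0), fun i => ?_⟩
    refine Fin.cases ?_ (fun i => ?_) i
    · simp [hw']
    · simp [hw, Fin.tail]

theorem LocAdd.factor_free (h : LocAdd A U C) {n : ℕ} (f : (Fin n → A) →ₗ[A] C) :
    ∃ (k : ℕ) (p : (Fin n → A) →ₗ[A] (Fin k → U)) (g : (Fin k → U) →ₗ[A] C), g ∘ₗ p = f := by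
  obtain ⟨k, g, w, hw⟩ := h.exists_cover n fun i => f (Pi.single i 1)
  refine ⟨k, Fintype.linearCombination A w, g, ?_⟩
  refine LinearMap.pi_ext' fun i => LinearMap.ext_ring ?_
  simp [hw]

theorem LocAdd.factor (h : LocAdd A U C) {Y : Type u} [AddCommGroup Y] [Module A Y]
    (hY : RetractPow A U Y ∨ RetractPow A A Y) (f : Y →ₗ[A] C) :
    ∃ (k : ℕ) (p : Y →ₗ[A] (Fin k → U)) (g : (Fin k → U) →ₗ[A] C), g ∘ₗ p = f := by
  rcases hY with ⟨k, i, r, hr⟩ | ⟨n, i, r, hr⟩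
  · exact ⟨k, i, f ∘ₗ r, by rw [LinearMap.comp_assoc, hr, LinearMap.comp_id]⟩
  · obtain ⟨k, p, g, hg⟩ := h.factor_free (f ∘ₗ r)
    exact ⟨k, p ∘ₗ i, g, by
      rw [← LinearMap.comp_assoc, hg, LinearMap.comp_assoc, hr, LinearMap.comp_id]⟩

theorem LocAdd.kill_finset (h : LocAdd A U C) {k : ℕ} (f : (Fin k → U) →ₗ[A] C)
    (s : Finset (Fin k → U)) (hs : ∀ w ∈ s, f w = 0) :
    ∃ (l : ℕ) (b : (Fin k → U) →ₗ[A] (Fin l → U)) (g : (Fin l → U) →ₗ[A] C),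
      g ∘ₗ b = f ∧ ∀ w ∈ s, b w = 0 := by
  classical
  induction s using Finset.induction with
  | empty => exact ⟨k, LinearMap.id, f, rfl, by simp⟩
  | insert w s _ ih =>
    obtain ⟨l, b, g, hg, hb⟩ := ih fun x hx => hs x (Finset.mem_insert_of_mem hx)
    obtain ⟨l', b', g', hg', hb'⟩ := h.kill l g (b w) (by
      rw [← LinearMap.comp_apply, hg]; exact hs w (Finset.mem_insert_self w s))
    refine ⟨l', b' ∘ₗ b, g', by rw [← LinearMap.comp_assoc, hg', hg], fun x hx => ?_⟩
    rcases Finset.mem_insert.1 hx with rfl | hx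
    · exact hb'
    · rw [LinearMap.comp_apply, hb x hx, map_zero]

variable {X Y Z : Type u} [AddCommGroup X] [AddCommGroup Y] [AddCommGroup Z]
  [Module A X] [Module A Y] [Module A Z]

/-- Only the images of finitely many generators of `X` have to be killed. -/
theorem LocAdd.factor_of_comp_eq_zero (h : LocAdd A U C) [Module.Finite A X]
    (hY : RetractPow A U Y ∨ RetractPow A A Y) (a : X →ₗ[A] Y) (f : Y →ₗ[A] C)
    (hf : f ∘ₗ a = 0) :
    ∃ (k : ℕ) (p : Y →ₗ[A] (Fin k → U)) (g : (Fin k → U) →ₗ[A] C),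
      g ∘ₗ p = f ∧ p ∘ₗ a = 0 := by
  classical
  obtain ⟨k, p, g, rfl⟩ := h.factor hY f
  obtain ⟨s, hs⟩ := Module.Finite.fg_top (R := A) (M := X)
  obtain ⟨l, b, g', rfl, hb⟩ := h.kill_finset g (s.image (p ∘ₗ a)) (by
    intro w hw
    obtain ⟨x, _, rfl⟩ := Finset.mem_image.1 hw
    exact LinearMap.congr_fun hf x)
  refine ⟨l, b ∘ₗ p, g', rfl, ?_⟩
  refine LinearMap.ext_on hs fun x hx => ?_
  exact hb _ (Finset.mem_image_of_mem _ hx)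

/-- The purpose of `LocAdd`: a cocycle with values in `C` comes from one with values in a finite
power of `U`, where it extends. -/
theorem LocAdd.homExact (h : LocAdd A U C) [Module.Finite A X]
    (hY : RetractPow A U Y ∨ RetractPow A A Y) {a : X →ₗ[A] Y} {b : Y →ₗ[A] Z}
    (hU : HomExact a b U) : HomExact a b C := by
  intro f hf
  obtain ⟨k, p, g, rfl, hp⟩ := h.factor_of_comp_eq_zero hY a f hf
  obtain ⟨q, rfl⟩ := hU.pi p hp
  exact ⟨g ∘ₗ q, rfl⟩

/-- Over a noetherian ring `M` is finitely presented: its generators lift to one stage, and its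
finitely many relations hold at a later one. -/
theorem exists_lift_directLimit [IsNoetherianRing A] {ι : Type u} [Preorder ι]
    [IsDirectedOrder ι] [Nonempty ι] [DecidableEq ι] (G : ι → ModuleCat.{u} A)
    (f : ∀ i j, i ≤ j → G i →ₗ[A] G j) [DirectedSystem (fun i => G i) fun i j h => f i j h]
    {M : Type u} [AddCommGroup M] [Module A M] [Module.Finite A M]
    (g : M →ₗ[A] Module.DirectLimit (fun i => G i) f) :
    ∃ (i : ι) (p : M →ₗ[A] G i), Module.DirectLimit.of A ι (fun i => G i) f i ∘ₗ p = g := by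
  obtain ⟨n, q, hq⟩ := Module.Finite.exists_fin' A M
  have hlift : ∀ (m : ℕ) (c : Fin m → Module.DirectLimit (fun i => G i) f),
      ∃ (i : ι) (x : Fin m → G i), ∀ t, Module.DirectLimit.of A ι (fun i => G i) f i (x t) = c t := by
    intro m c
    choose i x hx using fun t => Module.DirectLimit.exists_of (c t)
    obtain ⟨j, hj⟩ := Finset.exists_le (Finset.univ.image i)
    have hj' : ∀ t, i t ≤ j := fun t => hj _ (Finset.mem_image_of_mem _ (Finset.mem_univ t))
    exact ⟨j, fun t => f _ _ (hj' t) (x t), fun t => by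
      rw [Module.DirectLimit.of_f, hx]⟩
  obtain ⟨i, x, hx⟩ := hlift n fun t => g (q (Pi.single t 1))
  have hp : Module.DirectLimit.of A ι (fun i => G i) f i ∘ₗ Fintype.linearCombination A x
      = g ∘ₗ q := by
    refine LinearMap.pi_ext' fun t => LinearMap.ext_ring ?_
    simp [hx]
  obtain ⟨s, hs⟩ := (IsNoetherian.noetherian (LinearMap.ker q) : (LinearMap.ker q).FG)
  have hkill : ∀ s : Finset (Fin n → A), (∀ v ∈ s, q v = 0) →
      ∃ (j : ι) (hij : i ≤ j), ∀ v ∈ s, f i j hij (Fintype.linearCombination A x v) = 0 := by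
    classical
    intro s
    induction s using Finset.induction with
    | empty => exact fun _ => ⟨i, le_rfl, by simp⟩
    | insert v s _ ih =>
      intro h
      obtain ⟨j, hij, hj⟩ := ih fun v hv => h v (Finset.mem_insert_of_mem hv)
      obtain ⟨j', hij', hj'⟩ := Module.DirectLimit.of.zero_exact (R := A) (G := fun i => G i)
        (f := f) (i := i) (x := Fintype.linearCombination A x v) (by
          have := LinearMap.congr_fun hp v
          simp only [LinearMap.comp_apply] at this
          rw [this, h v (Finset.mem_insert_self v s), map_zero])
      obtain ⟨l, hl, hl'⟩ := exists_ge_ge j j'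
      have hmap : ∀ (a : ι) (hia : i ≤ a) (hal : a ≤ l) (y : G i),
          f i l (hia.trans hal) y = f a l hal (f i a hia y) := fun a hia hal y =>
        (DirectedSystem.map_map (f := fun i j h => f i j h) hia hal y).symm
      refine ⟨l, hij.trans hl, fun w hw => ?_⟩
      rcases Finset.mem_insert.1 hw with rfl | hw
      · rw [hmap j' hij' hl', hj', map_zero]
      · rw [hmap j hij hl, hj w hw, map_zero]
  obtain ⟨j, hij, hj⟩ := hkill s fun v hv => by
    have : v ∈ LinearMap.ker q := hs ▸ Submodule.subset_span hv
    exact this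
  obtain ⟨p, hp'⟩ := exists_desc_of_exact (ι := (LinearMap.ker q).subtype) hq
    (fun y => by simp) (f i j hij ∘ₗ Fintype.linearCombination A x) (by
      have hle : LinearMap.ker q ≤ LinearMap.ker (f i j hij ∘ₗ Fintype.linearCombination A x) := by
        rw [← hs, Submodule.span_le]
        exact fun v hv => hj v hv
      ext v
      exact hle v.2)
  refine ⟨j, p, ?_⟩
  ext y
  obtain ⟨v, rfl⟩ := hq y
  have h1 := LinearMap.congr_fun hp' v
  have h2 := LinearMap.congr_fun hp v
  simp only [LinearMap.comp_apply] at h1 h2 ⊢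
  rw [h1, Module.DirectLimit.of_f, h2]

theorem locAdd_directLimit [IsNoetherianRing A] [Module.Finite A U] {ι : Type u} [Preorder ι]
    [IsDirectedOrder ι] [Nonempty ι] [DecidableEq ι] (G : ι → ModuleCat.{u} A)
    (f : ∀ i j, i ≤ j → G i →ₗ[A] G j) [DirectedSystem (fun i => G i) fun i j h => f i j h]
    (hG : ∀ i, ∃ k : ℕ, Nonempty (G i ≃ₗ[A] (Fin k → U))) :
    LocAdd A U (Module.DirectLimit (fun i => G i) f) where
  cover c := by
    obtain ⟨i, x, rfl⟩ := Module.DirectLimit.exists_of c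
    obtain ⟨k, ⟨e⟩⟩ := hG i
    exact ⟨k, Module.DirectLimit.of A ι (fun i => G i) f i ∘ₗ e.symm.toLinearMap, e x, by simp⟩
  kill k g w hw := by
    obtain ⟨i, p, rfl⟩ := exists_lift_directLimit G f g
    obtain ⟨j, hij, hj⟩ := Module.DirectLimit.of.zero_exact (R := A) (G := fun i => G i) (f := f) hw
    obtain ⟨l, ⟨e⟩⟩ := hG j
    refine ⟨l, e.toLinearMap ∘ₗ f i j hij ∘ₗ p,
      Module.DirectLimit.of A ι (fun i => G i) f j ∘ₗ e.symm.toLinearMap, ?_, ?_⟩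
    · ext x
      simp
    · simp [hj]

theorem locAdd_finsupp [Module.Finite A U] (I : Type u) : LocAdd A U (I →₀ U) := by
  classical
  -- A finite set of indices splits off a finite power of `U`, and the image of a finitely generated
  -- module lies in such a part.
  have key : ∀ s : Finset I, ∃ (k : ℕ) (g : (Fin k → U) →ₗ[A] (I →₀ U))
      (p : (I →₀ U) →ₗ[A] (Fin k → U)), ∀ x : I →₀ U, x.support ⊆ s → g (p x) = x := by
    intro s
    let e := s.equivFin
    refine ⟨s.card, ∑ j, Finsupp.lsingle (e.symm j : I) ∘ₗ LinearMap.proj j,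
      LinearMap.pi fun j => Finsupp.lapply (e.symm j : I), fun x hx => ?_⟩
    simp only [LinearMap.sum_apply, LinearMap.comp_apply, LinearMap.proj_apply,
      LinearMap.pi_apply, Finsupp.lapply_apply, Finsupp.lsingle_apply]
    rw [Equiv.sum_comp e.symm (fun i : s => Finsupp.single (i : I) (x i)),
      Finset.sum_coe_sort s (fun i => Finsupp.single i (x i)), ← Finsupp.sum_of_support_subset x hx
      Finsupp.single (by simp), Finsupp.sum_single]
  refine ⟨fun c => ?_, fun k f w hw => ?_⟩
  · obtain ⟨k, g, p, h⟩ := key c.support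
    exact ⟨k, g, p c, h c subset_rfl⟩
  · obtain ⟨t, ht⟩ := Module.Finite.fg_top (R := A) (M := Fin k → U)
    obtain ⟨l, g, p, h⟩ := key (t.biUnion fun v => (f v).support)
    refine ⟨l, p ∘ₗ f, g, ?_, by rw [LinearMap.comp_apply, hw, map_zero]⟩
    refine LinearMap.ext_on ht fun v hv => h _ ?_
    exact Finset.subset_biUnion_of_mem (fun v => (f v).support) hv

theorem HasLifts.finsupp {T N : Type u} [AddCommGroup T] [AddCommGroup N] [Module A T]
    [Module A N] {π : T →ₗ[A] N} (hl : HasLifts π U) (I : Type u) : HasLifts π (I →₀ U) := by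
  intro f
  choose g hg using fun i => hl (f ∘ₗ Finsupp.lsingle i)
  refine ⟨Finsupp.lsum ℕ g, ?_⟩
  refine Finsupp.lhom_ext' fun i => ?_
  rw [← hg i]
  ext x
  simp

theorem LocAdd.of_isSummand {D : Type u} [AddCommGroup D] [Module A D] (h : LocAdd A U C)
    (hD : IsSummand A D C) : LocAdd A U D := by
  obtain ⟨Z, ⟨e⟩⟩ := hD
  refine h.of_retract (e.toLinearMap ∘ₗ LinearMap.inl A D Z)
    (LinearMap.fst A D Z ∘ₗ e.symm.toLinearMap) ?_
  ext x
  simp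

theorem locAdd_of_memBigAdd [Module.Finite A U] (M : ModuleCat.{u} A) (h : MemBigAdd A U M) :
    LocAdd A U M := by
  obtain ⟨I, hI⟩ := h
  exact (locAdd_finsupp I).of_isSummand hI

theorem locAdd_of_memAddLim [IsNoetherianRing A] [Module.Finite A U] (M : ModuleCat.{u} A)
    (h : MemAddLim A U M) : LocAdd A U M := by
  obtain ⟨ι, _, _, _, G, f, _, hG, hM⟩ := h
  classical
  exact (locAdd_directLimit G f hG).of_isSummand (by convert hM)

theorem locAdd_of_projective (P : Type u) [AddCommGroup P] [Module A P] [Module.Projective A P] :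
    LocAdd A A P := by
  obtain ⟨s, hs⟩ := Module.projective_def'.1 ‹Module.Projective A P›
  exact (locAdd_finsupp P).of_retract s _ hs

end LocAdd

/-! ### Sequences of free modules and injective dimension -/

section FreeSeq

/-- An exact sequence `⋯ → A ^ k 2 → A ^ k 1 → A ^ k 0`. -/
structure FreeSeq (A : Type u) [Ring A] where
  k : ℕ → ℕ
  d : ∀ i, (Fin (k (i + 1)) → A) →ₗ[A] (Fin (k i) → A)
  exact : ∀ i, Function.Exact (d (i + 1)) (d i)

variable {A : Type u} [Ring A]

/-- The sequence without its last term. -/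
def FreeSeq.shift (F : FreeSeq A) : FreeSeq A where
  k i := F.k (i + 1)
  d i := F.d (i + 1)
  exact i := F.exact (i + 1)

theorem FreeSeq.comp_eq_zero (F : FreeSeq A) (i : ℕ) : F.d i ∘ₗ F.d (i + 1) = 0 :=
  (F.exact i).linearMap_comp_eq_zero

theorem exists_exact_free [IsNoetherianRing A] {p q : ℕ} (φ : (Fin p → A) →ₗ[A] (Fin q → A)) :
    ∃ (r : ℕ) (ψ : (Fin r → A) →ₗ[A] (Fin p → A)), Function.Exact ψ φ := by
  obtain ⟨r, f, hf⟩ := Module.Finite.exists_fin' A (LinearMap.ker φ)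
  refine ⟨r, (LinearMap.ker φ).subtype ∘ₗ f, fun y => ⟨fun hy => ?_, ?_⟩⟩
  · obtain ⟨x, hx⟩ := hf ⟨y, hy⟩
    exact ⟨x, by simp [hx]⟩
  · rintro ⟨x, rfl⟩
    exact (f x).2

/-- A map between finite free modules. -/
structure FreeMap (A : Type u) [Ring A] where
  p : ℕ
  q : ℕ
  φ : (Fin p → A) →ₗ[A] (Fin q → A)

/-- A finite free cover of the kernel. -/
noncomputable def FreeMap.next [IsNoetherianRing A] (f : FreeMap A) : FreeMap A :=
  ⟨(exists_exact_free f.φ).choose, f.p, (exists_exact_free f.φ).choose_spec.choose⟩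

/-- The iterated covers of kernels. -/
noncomputable def FreeMap.iter [IsNoetherianRing A] (f : FreeMap A) : ℕ → FreeMap A
  | 0 => f
  | i + 1 => (f.iter i).next

/-- The extension of a map between finite free modules to an exact sequence. -/
noncomputable def FreeSeq.ofMap [IsNoetherianRing A] {p q : ℕ}
    (φ : (Fin p → A) →ₗ[A] (Fin q → A)) : FreeSeq A where
  k i := ((FreeMap.mk p q φ).iter i).q
  d i := ((FreeMap.mk p q φ).iter i).φ
  exact i := (exists_exact_free ((FreeMap.mk p q φ).iter i).φ).choose_spec.choose_spec

/-- For every exact sequence `F` of finite free modules `Hom(F, C)` is exact in degree `m + 1`;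
over a noetherian ring this says that the injective dimension of `C` is at most `m`. -/
def Coacyclic (A : Type u) [Ring A] (C : Type u) [AddCommGroup C] [Module A C] (m : ℕ) : Prop :=
  ∀ F : FreeSeq A, HomExact (F.d (m + 1)) (F.d m) C

/-- Deleting the last term of an exact sequence lowers the degree by one. -/
theorem Coacyclic.mono {C : Type u} [AddCommGroup C] [Module A C] {m m' : ℕ}
    (h : Coacyclic A C m) (hm : m ≤ m') : Coacyclic A C m' := by
  induction hm with
  | refl => exact h
  | step _ ih => exact fun F => ih F.shift

theorem homExact_of_injective {X Y Z E : Type u} [AddCommGroup X] [AddCommGroup Y]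
    [AddCommGroup Z] [AddCommGroup E] [Module A X] [Module A Y] [Module A Z] [Module A E]
    [hE : Module.Injective A E] {a : X →ₗ[A] Y} {b : Y →ₗ[A] Z} (h : Function.Exact a b) :
    HomExact a b E := by
  intro f hf
  obtain ⟨g, hg⟩ := exists_desc_of_exact (ι := a) b.surjective_rangeRestrict
    (fun y => by
      rw [← h y]
      exact ⟨fun hy => congrArg Subtype.val hy, fun hy => Subtype.ext hy⟩) f hf
  obtain ⟨k, hk⟩ := hE.out (LinearMap.range b).subtype Subtype.val_injective g
  refine ⟨k, ?_⟩
  ext y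
  rw [← hg]
  exact hk (b.rangeRestrict y)

/-! ### Dimension shifting along an injective embedding -/

section Shift

variable {C E N : Type u} [AddCommGroup C] [AddCommGroup E] [AddCommGroup N]
  [Module A C] [Module A E] [Module A N] {ι : C →ₗ[A] E} {π : E →ₗ[A] N}

theorem coacyclic_succ_iff [Module.Injective A E] (hι : Function.Injective ι)
    (hπ : Function.Surjective π) (h : Function.Exact ι π) (m : ℕ) :
    Coacyclic A C (m + 1) ↔ Coacyclic A N m := by
  refine ⟨fun hC F => ?_, fun hN F => ?_⟩
  · exact HomExact.right_of_shortExact hι h (F.comp_eq_zero (m + 1)) (hC F)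
      (homExact_of_injective (F.exact m)) (HasLifts.of_surjective hπ)
  · exact HomExact.left_of_shortExact hι h (F.comp_eq_zero m)
      (homExact_of_injective (F.exact (m + 1))) (hN F) (HasLifts.of_surjective hπ)

end Shift

/-- Baer's criterion: a left ideal `I` is finitely generated, so `A ^ n → I ⊆ A` continues to an
exact sequence of finite free modules. -/
theorem coacyclic_zero_iff [IsNoetherianRing A] (C : Type u) [AddCommGroup C] [Module A C] :
    Coacyclic A C 0 ↔ Module.Injective A C := by
  refine ⟨fun h => Module.Baer.injective fun I g => ?_, fun h F =>
    homExact_of_injective (F.exact 0)⟩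
  obtain ⟨n, q, hq⟩ := Module.Finite.exists_fin' A I
  let e : A →ₗ[A] (Fin 1 → A) := LinearMap.single A (fun _ => A) 0
  let φ : (Fin n → A) →ₗ[A] (Fin 1 → A) := e ∘ₗ I.subtype ∘ₗ q
  obtain ⟨k, hk⟩ := h (FreeSeq.ofMap φ) (g ∘ₗ q) (by
    refine LinearMap.ext fun x => ?_
    have h1 : φ _ = 0 := LinearMap.congr_fun ((FreeSeq.ofMap φ).comp_eq_zero 0) x
    have h2 : q ((FreeSeq.ofMap φ).d 1 x) = 0 := by
      refine Subtype.ext (Eq.trans ?_ (congrFun h1 0))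
      exact (Pi.single_eq_same (M := fun _ : Fin 1 => A) 0 _).symm
    exact (congrArg g h2).trans (map_zero g))
  refine ⟨k ∘ₗ e, fun x hx => ?_⟩
  obtain ⟨y, hy⟩ := hq ⟨x, hx⟩
  have h1 : k (φ y) = g (q y) := LinearMap.congr_fun hk y
  rw [← hy, ← h1]
  simp only [φ, LinearMap.comp_apply, Submodule.subtype_apply, hy]
  rfl

theorem exists_injective_embedding (C : Type u) [AddCommGroup C] [Module A C] :
    ∃ (E : ModuleCat.{u} A) (ι : C →ₗ[A] E), Module.Injective A E ∧ Function.Injective ι := by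
  refine ⟨Injective.under (ModuleCat.of A C), (Injective.ι (ModuleCat.of A C)).hom, ?_,
    (ModuleCat.mono_iff_injective _).1 inferInstance⟩
  exact (Module.injective_iff_injective_object A _).2
    (inferInstanceAs (Injective (Injective.under (ModuleCat.of A C))))

theorem shortExact_of_exact {K T N : Type u} [AddCommGroup K] [AddCommGroup T] [AddCommGroup N]
    [Module A K] [Module A T] [Module A N] {ι : K →ₗ[A] T} {π : T →ₗ[A] N}
    (hι : Function.Injective ι) (hπ : Function.Surjective π) (h : Function.Exact ι π) :
    (ShortComplex.mk (ModuleCat.ofHom ι) (ModuleCat.ofHom π)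
      (by ext x; exact h.apply_apply_eq_zero x)).ShortExact where
  exact := (ShortComplex.ShortExact.moduleCat_exact_iff_function_exact _).2 h
  mono_f := (ModuleCat.mono_iff_injective _).2 hι
  epi_g := (ModuleCat.epi_iff_surjective _).2 hπ

/-- Both conditions drop by one when `C` is replaced by its cokernel in an injective module. -/
theorem coacyclic_iff_hasInjectiveDimensionLE [IsNoetherianRing A] (m : ℕ) :
    ∀ (C : Type u) [AddCommGroup C] [Module A C],
      Coacyclic A C m ↔ HasInjectiveDimensionLE (ModuleCat.of A C) m := by
  induction m with
  | zero =>
    intro C _ _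
    rw [coacyclic_zero_iff, Module.injective_iff_injective_object,
      injective_iff_hasInjectiveDimensionLT_one]
  | succ m ih =>
    intro C _ _
    obtain ⟨E, ι, hE, hι⟩ := exists_injective_embedding (A := A) C
    have hex : Function.Exact ι (LinearMap.range ι).mkQ := by
      rw [LinearMap.exact_iff, Submodule.ker_mkQ]
    have hs := Submodule.mkQ_surjective (LinearMap.range ι)
    rw [coacyclic_succ_iff hι hs hex, ih]
    exact (shortExact_of_exact hι hs hex).hasInjectiveDimensionLT_X₃_iff m
      ((Module.injective_iff_injective_object A _).1 hE)

end FreeSeq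

/-! ### The duality between powers of `B = End U` and powers of `U` -/

section Dual

variable (A B : Type u) [Ring A] [Ring B] (U : Type u) [AddCommGroup U] [Module A U] [Module B U]
  [SMulCommClass B A U]

variable {B} in
/-- The map `U ^ k → U` given by a row with entries in `B`. -/
def rowMap {k : ℕ} (b : Fin k → B) : (Fin k → U) →ₗ[A] U :=
  ∑ i, Module.toModuleEnd A U (b i) ∘ₗ LinearMap.proj i

variable {B} in
/-- The map `U ^ k → U ^ l` dual to a map `B ^ l → B ^ k`. -/
def dualMap {k l : ℕ} (d : (Fin l → B) →ₗ[B] (Fin k → B)) : (Fin k → U) →ₗ[A] (Fin l → U) :=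
  LinearMap.pi fun j => rowMap A U (d (Pi.single j 1))

/-- For every exact sequence `F` of finite free `B`-modules the complex `Hom_A(Hom_B(F, U), N)` is
exact in degree `m + 1`. -/
def Acyclic (N : Type u) [AddCommGroup N] [Module A N] (m : ℕ) : Prop :=
  ∀ F : FreeSeq B, HomExact (dualMap A U (F.d m)) (dualMap A U (F.d (m + 1))) N

variable {A B U}

@[simp]
theorem rowMap_apply {k : ℕ} (b : Fin k → B) (x : Fin k → U) :
    rowMap A U b x = ∑ i, b i • x i := by
  simp [rowMap, LinearMap.sum_apply]

@[simp]
theorem dualMap_apply {k l : ℕ} (d : (Fin l → B) →ₗ[B] (Fin k → B)) (x : Fin k → U) (j : Fin l) :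
    dualMap A U d x j = ∑ i, d (Pi.single j 1) i • x i := by
  simp [dualMap]

theorem rowMap_dualMap {k l : ℕ} (d : (Fin l → B) →ₗ[B] (Fin k → B)) (b : Fin l → B)
    (x : Fin k → U) : rowMap A U b (dualMap A U d x) = rowMap A U (d b) x := by
  have : Fintype.linearCombination B (dualMap A U d x) = Fintype.linearCombination B x ∘ₗ d := by
    refine LinearMap.pi_ext' fun j => LinearMap.ext_ring ?_
    simp [Fintype.linearCombination_apply]
  simpa [Fintype.linearCombination_apply] using LinearMap.congr_fun this b

theorem rowMap_comp_dualMap {k l : ℕ} (d : (Fin l → B) →ₗ[B] (Fin k → B)) (b : Fin l → B) :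
    rowMap A U b ∘ₗ dualMap A U d = rowMap A U (d b) :=
  LinearMap.ext fun x => rowMap_dualMap d b x

theorem rowMap_single {k : ℕ} (j : Fin k) (x : Fin k → U) :
    rowMap A U (Pi.single j (1 : B)) x = x j := by
  rw [rowMap_apply, Finset.sum_eq_single j]
  · simp
  · intro i _ hi
    simp [hi]
  · simp

theorem dualMap_comp {k l m : ℕ} (d : (Fin l → B) →ₗ[B] (Fin k → B))
    (d' : (Fin m → B) →ₗ[B] (Fin l → B)) :
    dualMap A U d' ∘ₗ dualMap A U d = dualMap A U (d ∘ₗ d') := by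
  refine LinearMap.ext fun x => funext fun i => ?_
  have e : ∀ y : Fin m → U, rowMap A U (Pi.single i (1 : B)) y = y i := rowMap_single i
  refine (e _).symm.trans (Eq.trans ?_ (e _))
  simp only [LinearMap.comp_apply, rowMap_dualMap]

theorem dualMap_zero {k l : ℕ} : dualMap A U (0 : (Fin l → B) →ₗ[B] (Fin k → B)) = 0 := by
  refine LinearMap.ext fun x => funext fun i => ?_
  simp

theorem dualMap_comp_eq_zero (F : FreeSeq B) (i : ℕ) :
    dualMap A U (F.d (i + 1)) ∘ₗ dualMap A U (F.d i) = 0 := by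
  rw [dualMap_comp, F.comp_eq_zero, dualMap_zero]

section Endomorphisms

variable (hB : Function.Bijective (Module.toModuleEnd A (S := B) U))

include hB

theorem exists_rowMap_eq {k : ℕ} (f : (Fin k → U) →ₗ[A] U) : ∃ b : Fin k → B, rowMap A U b = f := by
  choose b hb using fun i => hB.2 (f ∘ₗ LinearMap.single A (fun _ => U) i)
  refine ⟨b, LinearMap.pi_ext' fun i => ?_⟩
  rw [← hb i]
  refine LinearMap.ext fun x => ?_
  rw [LinearMap.comp_apply, rowMap_apply, Finset.sum_eq_single i]
  · simp
  · intro j _ hj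
    simp [hj]
  · simp

theorem rowMap_injective {k : ℕ} {b : Fin k → B} (h : rowMap A U b = 0) : b = 0 := by
  funext i
  refine hB.1 ?_
  rw [Pi.zero_apply, map_zero]
  refine LinearMap.ext fun x => ?_
  have := LinearMap.congr_fun h (Pi.single i x)
  rw [rowMap_apply, Finset.sum_eq_single i] at this
  · simpa using this
  · intro j _ hj
    simp [hj]
  · simp

theorem exists_dualMap_eq {k l : ℕ} (δ : (Fin k → U) →ₗ[A] (Fin l → U)) :
    ∃ d : (Fin l → B) →ₗ[B] (Fin k → B), dualMap A U d = δ := by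
  choose b hb using fun j => exists_rowMap_eq hB (LinearMap.proj j ∘ₗ δ)
  refine ⟨Fintype.linearCombination B b, LinearMap.ext fun x => funext fun j => ?_⟩
  have := LinearMap.congr_fun (hb j) x
  simpa using this

/-- As `Hom_A(U, U) = B`, dualising twice gives back the exact sequence of free `B`-modules. -/
theorem homExact_dualMap {p q r : ℕ} {d : (Fin q → B) →ₗ[B] (Fin p → B)}
    {d' : (Fin r → B) →ₗ[B] (Fin q → B)} (h : Function.Exact d' d) :
    HomExact (dualMap A U d) (dualMap A U d') U := by
  intro f hf
  obtain ⟨b, rfl⟩ := exists_rowMap_eq hB f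
  rw [rowMap_comp_dualMap] at hf
  obtain ⟨c, rfl⟩ := (h b).1 (rowMap_injective hB hf)
  exact ⟨rowMap A U c, rowMap_comp_dualMap d' c⟩

theorem LocAdd.acyclic [Module.Finite A U] {N : Type u} [AddCommGroup N] [Module A N]
    (h : LocAdd A U N) (m : ℕ) : Acyclic A B U N m := fun F =>
  h.homExact (Or.inl (retractPow_pi _)) (homExact_dualMap hB (F.exact m))

/-- The equational criterion for flatness of `Hom_A(U, N)`: `δ` is dual to a map of free
`B`-modules, whose kernel has a finite free cover. -/
theorem Acyclic.factor [IsNoetherianRing B] {N : Type u} [AddCommGroup N] [Module A N]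
    (h : Acyclic A B U N 0) {k l : ℕ} (δ : (Fin k → U) →ₗ[A] (Fin l → U))
    (f : (Fin l → U) →ₗ[A] N) (hf : f ∘ₗ δ = 0) :
    ∃ (p : ℕ) (b : (Fin l → U) →ₗ[A] (Fin p → U)) (g : (Fin p → U) →ₗ[A] N),
      g ∘ₗ b = f ∧ b ∘ₗ δ = 0 := by
  obtain ⟨d, rfl⟩ := exists_dualMap_eq hB δ
  obtain ⟨g, hg⟩ := h (FreeSeq.ofMap d) f hf
  exact ⟨_, _, g, hg, dualMap_comp_eq_zero (FreeSeq.ofMap d) 0⟩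

end Endomorphisms

theorem Acyclic.mono {N : Type u} [AddCommGroup N] [Module A N] {m m' : ℕ}
    (h : Acyclic A B U N m) (hm : m ≤ m') : Acyclic A B U N m' := by
  induction hm with
  | refl => exact h
  | step _ ih => exact fun F => ih F.shift

theorem Acyclic.of_retract {N N' : Type u} [AddCommGroup N] [Module A N] [AddCommGroup N']
    [Module A N'] {m : ℕ} (h : Acyclic A B U N m) (i : N' →ₗ[A] N) (r : N →ₗ[A] N')
    (hr : r ∘ₗ i = LinearMap.id) : Acyclic A B U N' m :=
  fun F => (h F).of_retract i r hr

section ShortExact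

variable {K T N : Type u} [AddCommGroup K] [AddCommGroup T] [AddCommGroup N]
  [Module A K] [Module A T] [Module A N] {ι : K →ₗ[A] T} {π : T →ₗ[A] N}

/-- The lifting hypothesis makes `Hom_A(U, -)` exact on the sequence, with flat middle term; this
and the next lemma are the usual shifts of flat dimension. -/
theorem Acyclic.right_of_shortExact (hι : Function.Injective ι) (h : Function.Exact ι π)
    (hl : HasLifts π U) (hT : Acyclic A B U T 0) {m : ℕ} (hK : Acyclic A B U K m) :
    Acyclic A B U N (m + 1) := fun F =>
  HomExact.right_of_shortExact hι h (dualMap_comp_eq_zero F m) (hK F)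
    ((hT.mono (Nat.zero_le _)) F) hl.pi

theorem Acyclic.left_of_shortExact (hι : Function.Injective ι) (h : Function.Exact ι π)
    (hl : HasLifts π U) (hT : Acyclic A B U T 0) {m : ℕ} (hN : Acyclic A B U N (m + 1)) :
    Acyclic A B U K m := fun F =>
  HomExact.left_of_shortExact hι h (dualMap_comp_eq_zero F (m + 1)) ((hT.mono (Nat.zero_le _)) F)
    (hN F) hl.pi

end ShortExact

variable {Q : Type u} [AddCommGroup Q] [Module A Q]

/-- A vector in `U ^ k` is a map `B ^ k → U`, and it is killed by the dual map exactly when it is a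
cocycle. -/
theorem Coacyclic.exact_dualMap {m : ℕ} (h : Coacyclic B U m) (F : FreeSeq B) :
    Function.Exact (dualMap A U (F.d m)) (dualMap A U (F.d (m + 1))) := by
  intro x
  refine ⟨fun hx => ?_, ?_⟩
  · obtain ⟨g, hg⟩ := h F (Fintype.linearCombination B x) (LinearMap.ext fun b => by
      have := rowMap_dualMap (A := A) (F.d (m + 1)) b x
      rw [hx, map_zero, rowMap_apply] at this
      rw [LinearMap.comp_apply, Fintype.linearCombination_apply, ← this, LinearMap.zero_apply])
    refine ⟨fun i => g (Pi.single i 1), funext fun j => ?_⟩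
    have h1 : Fintype.linearCombination B (fun i => g (Pi.single i 1)) = g := by
      refine LinearMap.pi_ext' fun j => LinearMap.ext_ring ?_
      simp
    rw [dualMap_apply, ← Fintype.linearCombination_apply, h1]
    have h2 := LinearMap.congr_fun hg (Pi.single j 1)
    rw [LinearMap.comp_apply] at h2
    rw [h2]
    simp
  · rintro ⟨y, rfl⟩
    exact LinearMap.congr_fun (dualMap_comp_eq_zero F m) y

theorem Coacyclic.acyclic [Module.Injective A Q] {m : ℕ} (h : Coacyclic B U m) :
    Acyclic A B U Q m := fun F => homExact_of_injective (h.exact_dualMap F)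

theorem exists_apply_ne_zero (hQ : IsCoseparator (ModuleCat.of A Q)) {M : Type u}
    [AddCommGroup M] [Module A M] {x : M} (hx : x ≠ 0) : ∃ f : M →ₗ[A] Q, f x ≠ 0 := by
  by_contra! h
  have := hQ.def (ModuleCat.ofHom (LinearMap.toSpanSingleton A M x)) 0 (fun f => by
    ext
    simp [h f.hom])
  refine hx ?_
  have h1 := congrArg (fun f => f.hom (1 : A)) this
  simpa using h1

theorem Acyclic.coacyclic (hQ : IsCoseparator (ModuleCat.of A Q)) {m : ℕ}
    (h : Acyclic A B U Q m) : Coacyclic B U m := by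
  intro F f hf
  let x : Fin (F.k (m + 1)) → U := fun i => f (Pi.single i 1)
  have hfx : Fintype.linearCombination B x = f := by
    refine LinearMap.pi_ext' fun j => LinearMap.ext_ring ?_
    simp [x]
  have hx : dualMap A U (F.d (m + 1)) x = 0 := by
    funext j
    rw [dualMap_apply, ← Fintype.linearCombination_apply, hfx]
    exact LinearMap.congr_fun hf (Pi.single j 1)
  -- Otherwise the cogenerator detects `x` modulo the range; the detecting map factors through the
  -- next dual map, which kills `x`.
  have hmem : x ∈ LinearMap.range (dualMap A U (F.d m)) := by
    by_contra hmem
    obtain ⟨φ, hφ⟩ := exists_apply_ne_zero hQ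
      (x := (LinearMap.range (dualMap A U (F.d m))).mkQ x) (by simpa using hmem)
    obtain ⟨g, hg⟩ := h F (φ ∘ₗ (LinearMap.range (dualMap A U (F.d m))).mkQ) (by
      rw [LinearMap.comp_assoc, LinearMap.range_mkQ_comp, LinearMap.comp_zero])
    refine hφ ?_
    have := LinearMap.congr_fun hg x
    rw [LinearMap.comp_apply, hx, map_zero] at this
    exact this.symm
  obtain ⟨y, hy⟩ := hmem
  refine ⟨Fintype.linearCombination B y, LinearMap.ext fun b => ?_⟩
  rw [← hfx, ← hy, LinearMap.comp_apply, Fintype.linearCombination_apply,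
    Fintype.linearCombination_apply, ← rowMap_apply (A := A), ← rowMap_dualMap, rowMap_apply]

end Dual

/-! ### Resolutions -/

section Resolutions

variable {A : Type u} [Ring A]

/-- The resolution of the first syzygy. -/
def LeftResolution.tail {M : ModuleCat.{u} A} (T : LeftResolution M) :
    LeftResolution (ModuleCat.of A (LinearMap.ker T.ε)) where
  X i := T.X (i + 1)
  d i := T.d (i + 1)
  ε := (T.d 0).codRestrict (LinearMap.ker T.ε) fun x => T.exact_zero.apply_apply_eq_zero x
  surjective := by
    rintro ⟨y, hy⟩
    obtain ⟨x, hx⟩ := (T.exact_zero y).1 hy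
    exact ⟨x, Subtype.ext hx⟩
  exact_zero x := by
    rw [← T.exact_succ 0 x]
    exact ⟨fun h => congrArg Subtype.val h, fun h => Subtype.ext h⟩
  exact_succ i := T.exact_succ (i + 1)

/-- The resolution of `M` obtained from a resolution of the kernel of `X → M`. -/
def LeftResolution.cons {M X : ModuleCat.{u} A} (ε : X →ₗ[A] M) (hε : Function.Surjective ε)
    (T : LeftResolution (ModuleCat.of A (LinearMap.ker ε))) : LeftResolution M where
  X i := match i with
    | 0 => X
    | i + 1 => T.X i
  d i := match i with
    | 0 => (LinearMap.ker ε).subtype ∘ₗ T.ε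
    | i + 1 => T.d i
  ε := ε
  surjective := hε
  exact_zero y := by
    refine ⟨fun hy => ?_, ?_⟩
    · obtain ⟨x, hx⟩ := T.surjective ⟨y, hy⟩
      exact ⟨x, congrArg Subtype.val hx⟩
    · rintro ⟨x, rfl⟩
      exact (T.ε x).2
  exact_succ i := match i with
    | 0 => fun x => by
      rw [← T.exact_zero x]
      exact ⟨fun h => Subtype.ext h, fun h => congrArg Subtype.val h⟩
    | i + 1 => T.exact_succ i

theorem HasResolutionOfLength.induction {P : ModuleCat.{u} A → Prop}
    {motive : ℕ → ModuleCat.{u} A → Prop}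
    (zero : ∀ (X M : ModuleCat.{u} A), (X ≃ₗ[A] M) → P X → motive 0 M)
    (succ : ∀ (m : ℕ) (X M : ModuleCat.{u} A) (ε : X →ₗ[A] M), Function.Surjective ε → P X →
      motive m (ModuleCat.of A (LinearMap.ker ε)) → motive (m + 1) M) :
    ∀ (m : ℕ) (M : ModuleCat.{u} A), HasResolutionOfLength P M m → motive m M
  | 0, M, ⟨T, hP, h0⟩ => by
    refine zero (T.X 0) M (LinearEquiv.ofBijective T.ε ⟨?_, T.surjective⟩) (hP 0 le_rfl)
    rw [← LinearMap.ker_eq_bot, LinearMap.ker_eq_bot']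
    intro y hy
    obtain ⟨x, rfl⟩ := (T.exact_zero y).1 hy
    have := h0 1 Nat.zero_lt_one
    rw [Subsingleton.elim x 0, map_zero]
  | m + 1, M, ⟨T, hP, h0⟩ =>
    succ m (T.X 0) M T.ε T.surjective (hP 0 (Nat.zero_le _))
      (HasResolutionOfLength.induction zero succ m _ ⟨T.tail,
        fun i hi => hP (i + 1) (Nat.succ_le_succ hi), fun i hi => h0 (i + 1) (Nat.succ_lt_succ hi)⟩)

theorem HasResolutionOfLength.of_mem {P : ModuleCat.{u} A → Prop} {M : ModuleCat.{u} A}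
    (h : P M) : HasResolutionOfLength P M 0 := by
  refine ⟨{ X := fun i => match i with
              | 0 => M
              | _ + 1 => ModuleCat.of A PUnit
            d := fun _ => 0
            ε := LinearMap.id
            surjective := Function.surjective_id
            exact_zero := fun x => ?_
            exact_succ := fun i x => ?_ }, ?_, ?_⟩
  · exact ⟨fun hx => ⟨0, hx.symm⟩, fun ⟨_, hy⟩ => hy.symm⟩
  · exact ⟨fun _ => ⟨0, rfl⟩, fun _ => rfl⟩
  · intro i hi
    obtain rfl := Nat.le_zero.1 hi
    exact h
  · intro i hi
    obtain ⟨j, rfl⟩ := Nat.exists_eq_succ_of_ne_zero hi.ne'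
    exact inferInstanceAs (Subsingleton PUnit)

theorem HasResolutionOfLength.cons {P : ModuleCat.{u} A → Prop} {M X : ModuleCat.{u} A} {m : ℕ}
    (ε : X →ₗ[A] M) (hε : Function.Surjective ε) (hX : P X)
    (h : HasResolutionOfLength P (ModuleCat.of A (LinearMap.ker ε)) m) :
    HasResolutionOfLength P M (m + 1) := by
  obtain ⟨T, hP, h0⟩ := h
  refine ⟨LeftResolution.cons ε hε T, fun i hi => ?_, fun i hi => ?_⟩
  · cases i with
    | zero => exact hX
    | succ i => exact hP i (Nat.le_of_succ_le_succ hi)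
  · cases i with
    | zero => exact absurd hi (Nat.not_lt_zero _)
    | succ i => exact h0 i (Nat.lt_of_succ_lt_succ hi)

theorem HasResolutionOfLength.mono {P P' : ModuleCat.{u} A → Prop} (hP : ∀ M, P M → P' M)
    {M : ModuleCat.{u} A} {m : ℕ} (h : HasResolutionOfLength P M m) :
    HasResolutionOfLength P' M m := by
  obtain ⟨T, hT, h0⟩ := h
  exact ⟨T, fun i hi => hP _ (hT i hi), h0⟩

theorem resolDim_ne_top_iff {P : ModuleCat.{u} A → Prop} {M : ModuleCat.{u} A} :
    resolDim P M ≠ ⊤ ↔ ∃ m, HasResolutionOfLength P M m := by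
  simp [resolDim, iInf_eq_top]

theorem exact_ker_subtype {X Y : Type u} [AddCommGroup X] [AddCommGroup Y] [Module A X]
    [Module A Y] (f : X →ₗ[A] Y) : Function.Exact (LinearMap.ker f).subtype f := fun x => by
  simp

end Resolutions

/-! ### Modules without higher extensions by `U` -/

section ExtVanishing

variable {A : Type u} [Ring A]

theorem exists_extension_of_subsingleton_ext {K T M C : Type u} [AddCommGroup K] [AddCommGroup T]
    [AddCommGroup M] [AddCommGroup C] [Module A K] [Module A T] [Module A M] [Module A C]
    {ι : K →ₗ[A] T} {π : T →ₗ[A] M} (hι : Function.Injective ι) (hπ : Function.Surjective π)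
    (h : Function.Exact ι π)
    (hM : Subsingleton (Abelian.Ext (ModuleCat.of A M) (ModuleCat.of A C) 1)) (f : K →ₗ[A] C) :
    ∃ g : T →ₗ[A] C, g ∘ₗ ι = f := by
  have hS := shortExact_of_exact hι hπ h
  obtain ⟨x, hx⟩ := Abelian.Ext.contravariant_sequence_exact₁ hS (ModuleCat.of A C)
    (Abelian.Ext.mk₀ (ModuleCat.ofHom f)) rfl (hM.elim _ _)
  obtain ⟨g, rfl⟩ := (Abelian.Ext.mk₀_bijective _ _).2 x
  rw [Abelian.Ext.mk₀_comp_mk₀] at hx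
  have := (Abelian.Ext.mk₀_bijective _ _).1 hx
  exact ⟨g.hom, congrArg ModuleCat.Hom.hom this⟩

theorem subsingleton_ext_kernel {K T M C : Type u} [AddCommGroup K] [AddCommGroup T]
    [AddCommGroup M] [AddCommGroup C] [Module A K] [Module A T] [Module A M] [Module A C]
    {ι : K →ₗ[A] T} {π : T →ₗ[A] M} (hι : Function.Injective ι) (hπ : Function.Surjective π)
    (h : Function.Exact ι π) [Module.Projective A T] (n : ℕ)
    (hM : Subsingleton (Abelian.Ext (ModuleCat.of A M) (ModuleCat.of A C) (n + 2))) :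
    Subsingleton (Abelian.Ext (ModuleCat.of A K) (ModuleCat.of A C) (n + 1)) := by
  have hS := shortExact_of_exact hι hπ h
  have hT : Projective (ModuleCat.of A T) := (IsProjective.iff_projective T).1 inferInstance
  refine subsingleton_of_forall_eq 0 fun x => ?_
  obtain ⟨y, rfl⟩ := Abelian.Ext.contravariant_sequence_exact₁ hS (ModuleCat.of A C)
    x (show 1 + (n + 1) = n + 2 by omega) (hM.elim _ _)
  have : y = 0 := Abelian.Ext.eq_zero_of_projective (P := ModuleCat.of A T) y
  rw [this, Abelian.Ext.comp_zero]

/-- The cohomology here is `Ext^(i+1)(M, C)`; passing to the first syzygy reduces it to `Ext¹`. -/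
theorem LeftResolution.homExact_of_ext {C : Type u} [AddCommGroup C] [Module A C] (i : ℕ) :
    ∀ {M : ModuleCat.{u} A} (T : LeftResolution M), (∀ j, Module.Projective A (T.X j)) →
      (∀ j, Subsingleton (Abelian.Ext M (ModuleCat.of A C) (j + 1))) →
      HomExact (T.d (i + 1)) (T.d i) C := by
  induction i with
  | zero =>
    intro M T hT hM f hf
    obtain ⟨g, rfl⟩ := exists_desc_of_exact T.tail.surjective T.tail.exact_zero f hf
    obtain ⟨k, hk⟩ := exists_extension_of_subsingleton_ext (LinearMap.ker T.ε).injective_subtype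
      T.surjective (exact_ker_subtype T.ε) (hM 0) g
    exact ⟨k, by rw [← hk]; rfl⟩
  | succ i ih =>
    intro M T hT hM
    have := hT 0
    exact ih T.tail (fun j => hT (j + 1)) fun j =>
      subsingleton_ext_kernel (LinearMap.ker T.ε).injective_subtype T.surjective
        (exact_ker_subtype T.ε) j (hM (j + 1))

/-- `Hom(T, N)` is exact in positive degrees. -/
def LeftResolution.IsHomAcyclic {M : ModuleCat.{u} A} (T : LeftResolution M) (N : Type u)
    [AddCommGroup N] [Module A N] : Prop :=
  ∀ i, HomExact (T.d (i + 1)) (T.d i) N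

theorem LeftResolution.comp_eq_zero {M : ModuleCat.{u} A} (T : LeftResolution M) (i : ℕ) :
    T.d i ∘ₗ T.d (i + 1) = 0 := (T.exact_succ i).linearMap_comp_eq_zero

section ShortExact

variable {M : ModuleCat.{u} A} {P : LeftResolution M} (hP : ∀ i, Module.Projective A (P.X i))
  {K T N : Type u} [AddCommGroup K] [AddCommGroup T] [AddCommGroup N]
  [Module A K] [Module A T] [Module A N] {ι : K →ₗ[A] T} {π : T →ₗ[A] N}
  (hι : Function.Injective ι) (hπ : Function.Surjective π) (h : Function.Exact ι π)

include hP hι hπ h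

/-- This is `Ext¹(M, K) = 0`, computed from `P`. -/
theorem LeftResolution.IsHomAcyclic.hasLifts (hK : P.IsHomAcyclic K) : HasLifts π M := by
  intro f
  have := hP 0
  obtain ⟨g, hg⟩ := HomExact.exists_lift_of_shortExact hι h (P.comp_eq_zero 0) (hK 0)
    (fun f hf => exists_desc_of_exact P.surjective P.exact_zero f hf)
    (HasLifts.of_surjective hπ) (f ∘ₗ P.ε) (by
      rw [LinearMap.comp_assoc, P.exact_zero.linearMap_comp_eq_zero, LinearMap.comp_zero])
  refine ⟨g, LinearMap.ext fun x => ?_⟩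
  obtain ⟨y, rfl⟩ := P.surjective x
  exact LinearMap.congr_fun hg y

theorem LeftResolution.IsHomAcyclic.right_of_shortExact (hK : P.IsHomAcyclic K)
    (hT : P.IsHomAcyclic T) : P.IsHomAcyclic N := fun i => by
  have := hP (i + 1)
  exact HomExact.right_of_shortExact hι h (P.comp_eq_zero (i + 1)) (hK (i + 1)) (hT i)
    (HasLifts.of_surjective hπ)

end ShortExact

theorem LeftResolution.IsHomAcyclic.of_injective {M : ModuleCat.{u} A} (P : LeftResolution M)
    (E : Type u) [AddCommGroup E] [Module A E] [Module.Injective A E] : P.IsHomAcyclic E :=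
  fun i => homExact_of_injective (P.exact_succ i)

theorem LocAdd.isHomAcyclic {U : Type u} [AddCommGroup U] [Module A U] {M : ModuleCat.{u} A}
    {P : LeftResolution M} (hP : ∀ i, Module.Finite A (P.X i) ∧ Module.Projective A (P.X i))
    (hU : P.IsHomAcyclic U) {N : Type u} [AddCommGroup N] [Module A N] (h : LocAdd A U N) :
    P.IsHomAcyclic N := fun i => by
  have := (hP (i + 1)).1
  have := (hP (i + 1)).2
  have := (hP (i + 2)).1
  exact h.homExact (Or.inr (retractPow_self_of_projective _)) (hU i)

end ExtVanishing

/-! ### Finite resolutions and acyclicity -/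

section Dimension

variable {A B : Type u} [Ring A] [Ring B] {U : Type u} [AddCommGroup U] [Module A U] [Module B U]
  [SMulCommClass B A U]

theorem Acyclic.of_equiv {N N' : Type u} [AddCommGroup N] [Module A N] [AddCommGroup N']
    [Module A N'] {m : ℕ} (h : Acyclic A B U N m) (e : N ≃ₗ[A] N') : Acyclic A B U N' m :=
  h.of_retract e.symm.toLinearMap e.toLinearMap (by ext x; simp)

theorem acyclic_of_hasResolutionOfLength_locAdd
    (hB : Function.Bijective (Module.toModuleEnd A (S := B) U)) [Module.Finite A U]
    {P : LeftResolution (ModuleCat.of A U)}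
    (hP : ∀ i, Module.Finite A (P.X i) ∧ Module.Projective A (P.X i)) (hU : P.IsHomAcyclic U)
    (m : ℕ) (M : ModuleCat.{u} A) (h : HasResolutionOfLength (fun X => LocAdd A U X) M m) :
    Acyclic A B U M m := by
  -- The vanishing of `Ext^i(U, -)` is carried along, since lifting maps from `U` along `ε` needs it
  -- for the kernel.
  refine (HasResolutionOfLength.induction
    (motive := fun m M => Acyclic A B U M m ∧ P.IsHomAcyclic M) ?_ ?_ m M h).1
  · intro X M e hX
    have hM : LocAdd A U M := hX.of_retract e.symm.toLinearMap e.toLinearMap (by ext x; simp)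
    exact ⟨hM.acyclic hB 0, hM.isHomAcyclic hP hU⟩
  · intro m X M ε hε hX hK
    have hX' := hX.isHomAcyclic hP hU
    have hP' := fun i => (hP i).2
    exact ⟨Acyclic.right_of_shortExact (LinearMap.ker ε).injective_subtype (exact_ker_subtype ε)
      (hK.2.hasLifts hP' (LinearMap.ker ε).injective_subtype hε (exact_ker_subtype ε))
      (hX.acyclic hB 0) hK.1,
      hK.2.right_of_shortExact hP' (LinearMap.ker ε).injective_subtype hε (exact_ker_subtype ε) hX'⟩

theorem acyclic_of_hasResolutionOfLength [Module.Projective A U] {Φ : ModuleCat.{u} A → Prop}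
    (hΦ : ∀ X, Φ X → Acyclic A B U X 0) (m : ℕ) (M : ModuleCat.{u} A)
    (h : HasResolutionOfLength Φ M m) : Acyclic A B U M m := by
  refine HasResolutionOfLength.induction (motive := fun m M => Acyclic A B U M m) ?_ ?_ m M h
  · exact fun X M e hX => (hΦ X hX).of_equiv e
  · intro m X M ε hε hX hK
    exact Acyclic.right_of_shortExact (LinearMap.ker ε).injective_subtype (exact_ker_subtype ε)
      (HasLifts.of_surjective hε) (hΦ X hX) hK

theorem exists_hasResolutionOfLength_of_acyclic [Module.Projective A U]
    {Φ : ModuleCat.{u} A → Prop} (hΦ : ∀ X : ModuleCat.{u} A, Acyclic A B U X 0 → Φ X)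
    (hfree : ∀ I : Type u, Acyclic A B U (I →₀ A) 0) (m : ℕ) :
    ∀ M : ModuleCat.{u} A, Acyclic A B U M m → HasResolutionOfLength Φ M m := by
  induction m with
  | zero => exact fun M hM => .of_mem (hΦ M hM)
  | succ m ih =>
    intro M hM
    have hs : Function.Surjective (Finsupp.linearCombination A (id : M → M)) :=
      Finsupp.linearCombination_id_surjective A M
    exact .cons (X := ModuleCat.of A (M →₀ A)) _ hs (hΦ _ (hfree M)) (ih _
      (Acyclic.left_of_shortExact (LinearMap.ker _).injective_subtype (exact_ker_subtype _)
        (HasLifts.of_surjective hs) (hfree M) hM))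

theorem acyclic_of_hasProjectiveDimensionLE [Module.Projective A U]
    (hproj : ∀ (X : Type u) [AddCommGroup X] [Module A X], Module.Projective A X →
      Acyclic A B U X 0) (m : ℕ) :
    ∀ M : ModuleCat.{u} A, HasProjectiveDimensionLE M m → Acyclic A B U M m := by
  induction m with
  | zero =>
    intro M hM
    exact hproj M ((IsProjective.iff_projective M).2
      (projective_iff_hasProjectiveDimensionLT_one.2 hM))
  | succ m ih =>
    intro M hM
    have hs : Function.Surjective (Finsupp.linearCombination A (id : M → M)) :=
      Finsupp.linearCombination_id_surjective A M
    have hP : Projective (ModuleCat.of A (M →₀ A)) :=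
      (IsProjective.iff_projective (M →₀ A)).1 inferInstance
    have hK := ((shortExact_of_exact (LinearMap.ker _).injective_subtype hs
      (exact_ker_subtype _)).hasProjectiveDimensionLT_X₃_iff m hP).1 hM
    exact Acyclic.right_of_shortExact (LinearMap.ker _).injective_subtype (exact_ker_subtype _)
      (HasLifts.of_surjective hs) (hproj _ inferInstance) (ih _ hK)

end Dimension

/-! ### Modules on which the coresolution of the ring is exact -/

section Static

variable {A : Type u} [Ring A] {U : Type u} [AddCommGroup U] [Module A U]

/-- The terms of the exact sequence `0 → A → U₀ → U₁ → ⋯`. -/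
def AddCoresolution.obj (K : AddCoresolution A U) : ℕ → ModuleCat.{u} A
  | 0 => ModuleCat.of A PUnit
  | 1 => ModuleCat.of A A
  | i + 2 => K.X i

/-- The maps of the exact sequence `0 → A → U₀ → U₁ → ⋯`. -/
def AddCoresolution.map (K : AddCoresolution A U) : ∀ i, K.obj i →ₗ[A] K.obj (i + 1)
  | 0 => 0
  | 1 => K.η
  | i + 2 => K.d i

theorem AddCoresolution.exact (K : AddCoresolution A U) :
    ∀ i, Function.Exact (K.map i) (K.map (i + 1))
  | 0 => fun x => ⟨fun hx => ⟨0, (K.injective (hx.trans (map_zero K.η).symm)).symm⟩, by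
      rintro ⟨_, rfl⟩
      exact map_zero K.η⟩
  | 1 => K.exact_zero
  | i + 2 => K.exact_succ i

/-- `Hom(K, N)` is exact, where `K` is the exact sequence `0 → A → U₀ → U₁ → ⋯`. -/
def AddCoresolution.IsHomAcyclic (K : AddCoresolution A U) (N : Type u) [AddCommGroup N]
    [Module A N] : Prop :=
  ∀ i, HomExact (K.map i) (K.map (i + 1)) N

theorem AddCoresolution.isHomAcyclic_self (K : AddCoresolution A U) : K.IsHomAcyclic U
  | 0 => fun f _ => K.hom_surjective f
  | 1 => fun f hf => (K.hom_exact_zero f).1 hf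
  | i + 2 => fun f hf => (K.hom_exact_succ i f).1 hf

theorem AddCoresolution.retractPow (K : AddCoresolution A U) :
    ∀ i, RetractPow A U (K.obj i) ∨ RetractPow A A (K.obj i)
  | 0 => Or.inl ⟨0, 0, 0, LinearMap.ext fun _ => rfl⟩
  | 1 => Or.inr (show RetractPow A A A from retractPow_self_of_projective A)
  | i + 2 => by
    obtain ⟨k, hk⟩ := K.mem i
    exact Or.inl (retractPow_of_isSummand hk)

theorem AddCoresolution.finite (K : AddCoresolution A U) [Module.Finite A U] (i : ℕ) :
    Module.Finite A (K.obj i) := by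
  rcases K.retractPow i with h | h
  · exact h.finite
  · exact h.finite

theorem AddCoresolution.hasLifts (K : AddCoresolution A U) {T N : Type u} [AddCommGroup T]
    [AddCommGroup N] [Module A T] [Module A N] {π : T →ₗ[A] N} (hπ : Function.Surjective π)
    (hl : HasLifts π U) (i : ℕ) : HasLifts π (K.obj i) := by
  rcases K.retractPow i with h | h
  · exact h.hasLifts hl
  · exact h.hasLifts (HasLifts.of_surjective hπ)

theorem AddCoresolution.isHomAcyclic_of_injective (K : AddCoresolution A U) (Q : Type u)
    [AddCommGroup Q] [Module A Q] [Module.Injective A Q] : K.IsHomAcyclic Q :=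
  fun i => homExact_of_injective (K.exact i)

theorem LocAdd.isHomAcyclic_coresolution [Module.Finite A U] (K : AddCoresolution A U)
    {N : Type u} [AddCommGroup N] [Module A N] (h : LocAdd A U N) : K.IsHomAcyclic N := fun i => by
  have := K.finite i
  exact h.homExact (K.retractPow (i + 1)) (K.isHomAcyclic_self i)

theorem AddCoresolution.IsHomAcyclic.left_of_shortExact {K : AddCoresolution A U}
    {L T N : Type u} [AddCommGroup L] [AddCommGroup T] [AddCommGroup N]
    [Module A L] [Module A T] [Module A N] {ι : L →ₗ[A] T} {π : T →ₗ[A] N}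
    (hι : Function.Injective ι) (hπ : Function.Surjective π) (h : Function.Exact ι π)
    (hl : HasLifts π U) (hT : K.IsHomAcyclic T) (hN : K.IsHomAcyclic N) : K.IsHomAcyclic L :=
  fun i => HomExact.left_of_shortExact hι h (K.exact (i + 1)).linearMap_comp_eq_zero (hT i)
    (hN (i + 1)) (K.hasLifts hπ hl (i + 3))

theorem AddCoresolution.IsHomAcyclic.exists_extension {K : AddCoresolution A U} {N : Type u}
    [AddCommGroup N] [Module A N] (h : K.IsHomAcyclic N) (x : N) :
    ∃ g : K.X 0 →ₗ[A] N, g (K.η 1) = x := by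
  obtain ⟨g, hg⟩ := h 0 (LinearMap.toSpanSingleton A N x)
    (LinearMap.ext fun _ => map_zero (LinearMap.toSpanSingleton A N x))
  exact ⟨g, (LinearMap.congr_fun hg (1 : A)).trans (one_smul A x)⟩

theorem AddCoresolution.IsHomAcyclic.exists_comp_d_eq {K : AddCoresolution A U} {N : Type u}
    [AddCommGroup N] [Module A N] (h : K.IsHomAcyclic N) (f : K.X 0 →ₗ[A] N)
    (hf : f (K.η 1) = 0) : ∃ g : K.X 1 →ₗ[A] N, g ∘ₗ K.d 0 = f :=
  h 1 f (LinearMap.ext_ring hf)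

theorem AddCoresolution.IsHomAcyclic.exists_cover {K : AddCoresolution A U} {N : Type u}
    [AddCommGroup N] [Module A N] (h : K.IsHomAcyclic N) (x : N) :
    ∃ (k : ℕ) (g : (Fin k → U) →ₗ[A] N) (w : Fin k → U), g w = x := by
  obtain ⟨g, hg⟩ := h.exists_extension x
  obtain ⟨k, hk⟩ := K.mem 0
  obtain ⟨k, i, r, hr⟩ := retractPow_of_isSummand hk
  refine ⟨k, g ∘ₗ r, i (K.η 1), ?_⟩
  have h1 : r (i (K.η 1)) = K.η 1 := LinearMap.congr_fun hr (K.η 1)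
  rw [LinearMap.comp_apply, h1, hg]

/-- Exactness of `Hom(K, C)` turns an element of `C`, or the relation `f x = 0`, into maps out of
`U₀` and `U₁`; flatness then resolves relations between such maps. -/
theorem AddCoresolution.IsHomAcyclic.locAdd {B : Type u} [Ring B] [IsNoetherianRing B] [Module B U]
    [SMulCommClass B A U] (hB : Function.Bijective (Module.toModuleEnd A (S := B) U))
    {K : AddCoresolution A U} {C : Type u} [AddCommGroup C] [Module A C]
    (h : K.IsHomAcyclic C) (hC : Acyclic A B U C 0) : LocAdd A U C where
  cover := h.exists_cover
  kill k f x hx := by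
    have hpow : K.IsHomAcyclic (Fin k → U) := fun i => (K.isHomAcyclic_self i).pi
    obtain ⟨w, hw⟩ := hpow.exists_extension x
    obtain ⟨t, ht⟩ := h.exists_comp_d_eq (f ∘ₗ w) (by rw [LinearMap.comp_apply, hw, hx])
    obtain ⟨_, h0⟩ := K.mem 0
    obtain ⟨p, i₀, r₀, hr₀⟩ := retractPow_of_isSummand h0
    obtain ⟨_, h1⟩ := K.mem 1
    obtain ⟨q, i₁, r₁, hr₁⟩ := retractPow_of_isSummand h1
    have hr₀' : ∀ y, r₀ (i₀ y) = y := LinearMap.congr_fun hr₀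
    have hr₁' : ∀ y, r₁ (i₁ y) = y := LinearMap.congr_fun hr₁
    have ht' : ∀ y, t (K.d 0 y) = f (w y) := LinearMap.congr_fun ht
    let e := powProdEquiv A U k q
    -- The pair `(f, -t)` vanishes on the image of `(w, K.d 0)`, and the retractions make this a
    -- relation between powers of `U`. At `K.η 1` the second coordinate is zero, so `b` kills `(x,
    -- 0)`.
    obtain ⟨l, b, g, hg, hb⟩ := hC.factor hB
      (e.toLinearMap ∘ₗ (LinearMap.prod w (i₁ ∘ₗ K.d 0)) ∘ₗ r₀)
      ((f ∘ₗ LinearMap.fst A _ _ - t ∘ₗ r₁ ∘ₗ LinearMap.snd A _ _) ∘ₗ e.symm.toLinearMap) (by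
        refine LinearMap.ext fun y => ?_
        have : f (w (r₀ y)) - t (r₁ (i₁ (K.d 0 (r₀ y)))) = 0 := by
          rw [hr₁', ht', sub_self]
        simpa using this)
    refine ⟨l, b ∘ₗ e.toLinearMap ∘ₗ LinearMap.inl A _ _, g, ?_, ?_⟩
    · rw [← LinearMap.comp_assoc, hg]
      refine LinearMap.ext fun y => ?_
      simp
    · have h2 : b (e (w (r₀ (i₀ (K.η 1))), i₁ (K.d 0 (r₀ (i₀ (K.η 1)))))) = 0 :=
        LinearMap.congr_fun hb (i₀ (K.η 1))
      rw [hr₀', K.exact_zero.apply_apply_eq_zero, hw, map_zero] at h2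
      exact h2

theorem LocAdd.coacyclic {C : Type u} [AddCommGroup C] [Module A C] (h : LocAdd A U C) {n : ℕ}
    (hU : Coacyclic A U n) : Coacyclic A C n := fun F =>
  h.homExact (Or.inr (retractPow_pi _)) (hU F)

end Static

theorem exists_injective_cogenerator (A : Type u) [Ring A] :
    ∃ Q : ModuleCat.{u} A, Module.Injective A Q ∧ IsCoseparator Q := by
  obtain ⟨Q, hQ, hQ'⟩ := Abelian.has_injective_coseparator _
    (isSeparator_separator (ModuleCat.{u} A))
  exact ⟨Q, (Module.injective_iff_injective_object A Q).2 hQ, hQ'⟩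

/-! ### Syzygies relative to `U` -/

section Syzygy

variable (A : Type u) [Ring A] (U : Type u) [AddCommGroup U] [Module A U]

/-- The canonical map from a direct sum of copies of `U`. -/
noncomputable def evalSum (N : Type u) [AddCommGroup N] [Module A N] :
    ((U →ₗ[A] N) →₀ U) →ₗ[A] N :=
  Finsupp.lsum ℕ fun f => f

/-- The iterated kernels of the canonical maps. -/
noncomputable def relSyzygy (N : ModuleCat.{u} A) : ℕ → ModuleCat.{u} A
  | 0 => N
  | i + 1 => ModuleCat.of A (LinearMap.ker (evalSum A U (relSyzygy N i)))

variable {A U}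

theorem hasLifts_evalSum (N : Type u) [AddCommGroup N] [Module A N] :
    HasLifts (evalSum A U N) U := fun f =>
  ⟨Finsupp.lsingle f, LinearMap.ext fun x => by simp [evalSum]⟩

theorem AddCoresolution.IsHomAcyclic.evalSum_surjective {K : AddCoresolution A U} {N : Type u}
    [AddCommGroup N] [Module A N] (h : K.IsHomAcyclic N) : Function.Surjective (evalSum A U N) := by
  intro x
  obtain ⟨k, g, w, rfl⟩ := h.exists_cover x
  refine ⟨∑ j, Finsupp.single (g ∘ₗ LinearMap.single A (fun _ => U) j) (w j), ?_⟩
  rw [map_sum]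
  simp only [evalSum, Finsupp.lsum_single, LinearMap.comp_apply, LinearMap.coe_single]
  rw [← map_sum, Finset.univ_sum_single]

variable [Module.Finite A U] {K : AddCoresolution A U} {N : ModuleCat.{u} A}

theorem AddCoresolution.IsHomAcyclic.relSyzygy (h : K.IsHomAcyclic N) :
    ∀ i, K.IsHomAcyclic (relSyzygy A U N i)
  | 0 => h
  | i + 1 => AddCoresolution.IsHomAcyclic.left_of_shortExact (LinearMap.ker _).injective_subtype
      (AddCoresolution.IsHomAcyclic.relSyzygy h i).evalSum_surjective (exact_ker_subtype _)
      (hasLifts_evalSum _) ((locAdd_finsupp _).isHomAcyclic_coresolution K)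
      (AddCoresolution.IsHomAcyclic.relSyzygy h i)

-- One dimension shift done by hand: extend `φ` into `E`, pass to the induced map into `D'`, extend
-- that over `T₀`, lift it back to `E` and subtract.
omit [Module.Finite A U] in
theorem exists_extension_of_kernel {D E D' T₁ L T₀ : Type u} [AddCommGroup D] [AddCommGroup E]
    [AddCommGroup D'] [AddCommGroup T₁] [AddCommGroup L] [AddCommGroup T₀] [Module A D]
    [Module A E] [Module A D'] [Module A T₁] [Module A L] [Module A T₀] [hE : Module.Injective A E]
    {ι : D →ₗ[A] E} {π : E →ₗ[A] D'} (hι : Function.Injective ι) (hex : Function.Exact ι π)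
    {σ : T₁ →ₗ[A] L} (hσ : Function.Surjective σ) (κ : L →ₗ[A] T₀) (hl : HasLifts π T₀)
    (hκ : ∀ χ : L →ₗ[A] D', ∃ χ' : T₀ →ₗ[A] D', χ' ∘ₗ κ = χ) (φ : LinearMap.ker σ →ₗ[A] D) :
    ∃ g : T₁ →ₗ[A] D, g ∘ₗ (LinearMap.ker σ).subtype = φ := by
  obtain ⟨ψ, hψ⟩ := hE.out (LinearMap.ker σ).subtype Subtype.val_injective (ι ∘ₗ φ)
  obtain ⟨χ, hχ⟩ := exists_desc_of_exact hσ (exact_ker_subtype σ) (π ∘ₗ ψ)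
    (LinearMap.ext fun x => by
      rw [LinearMap.comp_apply, LinearMap.comp_apply, hψ]
      exact hex.apply_apply_eq_zero _)
  obtain ⟨χ', hχ'⟩ := hκ χ
  obtain ⟨θ, hθ⟩ := hl χ'
  obtain ⟨k, hk⟩ := exists_comp_eq_of_exact hι hex (ψ - θ ∘ₗ κ ∘ₗ σ) (by
    rw [LinearMap.comp_sub, ← LinearMap.comp_assoc, hθ, ← LinearMap.comp_assoc, hχ', hχ,
      sub_self])
  refine ⟨k, LinearMap.ext fun x => hι ?_⟩
  have h1 := LinearMap.congr_fun hk ((LinearMap.ker σ).subtype x)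
  have h2 := hψ x
  have h3 : σ ((LinearMap.ker σ).subtype x) = 0 := x.2
  simp only [LinearMap.comp_apply, LinearMap.sub_apply] at h1 h2 ⊢
  rw [h1, h2, h3, map_zero, map_zero, sub_zero]

omit [Module.Finite A U] in
theorem exists_section_of_retraction {T L : Type u} [AddCommGroup T] [AddCommGroup L] [Module A T]
    [Module A L] {σ : T →ₗ[A] L} (hσ : Function.Surjective σ) (g : T →ₗ[A] LinearMap.ker σ)
    (hg : g ∘ₗ (LinearMap.ker σ).subtype = LinearMap.id) :
    ∃ s : L →ₗ[A] T, σ ∘ₗ s = LinearMap.id := by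
  obtain ⟨s, hs⟩ := exists_desc_of_exact hσ (exact_ker_subtype σ)
    (LinearMap.id - (LinearMap.ker σ).subtype ∘ₗ g) (by
      rw [LinearMap.sub_comp, LinearMap.comp_assoc, hg, LinearMap.id_comp, LinearMap.comp_id,
        sub_self])
  refine ⟨s, LinearMap.ext fun x => ?_⟩
  obtain ⟨y, rfl⟩ := hσ x
  have h1 := LinearMap.congr_fun hs y
  have h2 : σ ((LinearMap.ker σ).subtype (g y)) = 0 := (g y).2
  simp only [LinearMap.comp_apply, LinearMap.sub_apply, LinearMap.id_apply] at h1 ⊢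
  rw [h1, map_sub, h2, sub_zero]

/-- This is `Ext¹(L j, D) = Ext^(j+1)(N, D) = 0` for the relative syzygies `L j`. Each step replaces
`D` by a cosyzygy, which lowers its injective dimension and keeps `Ext^i(U, D) = 0`. -/
theorem exists_extension_relSyzygy (h : K.IsHomAcyclic N) [IsNoetherianRing A]
    {P : LeftResolution (ModuleCat.of A U)} (hP : ∀ i, Module.Projective A (P.X i)) (j : ℕ) :
    ∀ (D : Type u) [AddCommGroup D] [Module A D], Coacyclic A D j → P.IsHomAcyclic D →
      ∀ φ : LinearMap.ker (evalSum A U (relSyzygy A U N j)) →ₗ[A] D,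
        ∃ g : ((U →ₗ[A] relSyzygy A U N j) →₀ U) →ₗ[A] D,
          g ∘ₗ (LinearMap.ker (evalSum A U (relSyzygy A U N j))).subtype = φ := by
  induction j with
  | zero =>
    intro D _ _ hD _ φ
    obtain ⟨g, hg⟩ := ((coacyclic_zero_iff D).1 hD).out
      (LinearMap.ker (evalSum A U (relSyzygy A U N 0))).subtype Subtype.val_injective φ
    exact ⟨g, LinearMap.ext hg⟩
  | succ j ih =>
    intro D _ _ hD hPD φ
    obtain ⟨E, ι, hE, hι⟩ := exists_injective_embedding (A := A) D
    have hex : Function.Exact ι (LinearMap.range ι).mkQ := by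
      rw [LinearMap.exact_iff, Submodule.ker_mkQ]
    have hπ : Function.Surjective (LinearMap.range ι).mkQ :=
      Submodule.mkQ_surjective (LinearMap.range ι)
    have hl : HasLifts (LinearMap.range ι).mkQ U := hPD.hasLifts hP hι hπ hex
    exact exists_extension_of_kernel hι hex (h.relSyzygy (j + 1)).evalSum_surjective
      (LinearMap.ker (evalSum A U (relSyzygy A U N j))).subtype (hl.finsupp _)
      (ih (E ⧸ LinearMap.range ι) ((coacyclic_succ_iff hι hπ hex j).1 hD)
        (hPD.right_of_shortExact hP hι hπ hex (.of_injective P E))) φ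

variable {B : Type u} [Ring B] [Module B U] [SMulCommClass B A U]
  (hB : Function.Bijective (Module.toModuleEnd A (S := B) U))

include hB

/-- The covers stay exact under `Hom_A(U, -)` and become flat, so `i` syzygies lower the flat
dimension by `i`; the next lemma goes back. -/
theorem acyclic_relSyzygy (h : K.IsHomAcyclic N) (m : ℕ) :
    ∀ i j : ℕ, i + j = m → Acyclic A B U N m → Acyclic A B U (relSyzygy A U N i) j
  | 0, j, hij, hN => by
    rw [Nat.zero_add] at hij
    subst hij
    exact hN
  | i + 1, j, hij, hN => Acyclic.left_of_shortExact (LinearMap.ker _).injective_subtype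
      (exact_ker_subtype _) (hasLifts_evalSum _) ((locAdd_finsupp _).acyclic hB 0)
      (acyclic_relSyzygy h m i (j + 1) (by omega) hN)

theorem acyclic_of_relSyzygy (h : K.IsHomAcyclic N) :
    ∀ i j : ℕ, Acyclic A B U (relSyzygy A U N i) j → Acyclic A B U N (i + j)
  | 0, j, hN => by
    rw [Nat.zero_add]
    exact hN
  | i + 1, j, hN => by
    have := acyclic_of_relSyzygy h i (j + 1)
      (Acyclic.right_of_shortExact (LinearMap.ker _).injective_subtype
      (exact_ker_subtype _) (hasLifts_evalSum _) ((locAdd_finsupp _).acyclic hB 0) hN)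
    rwa [Nat.add_right_comm i 1 j]

variable [IsNoetherianRing A] [IsNoetherianRing B] {P : LeftResolution (ModuleCat.of A U)}
  (hP : ∀ i, Module.Finite A (P.X i) ∧ Module.Projective A (P.X i)) (hU : P.IsHomAcyclic U)

include hP hU

theorem acyclic_pred_of_injective (K : AddCoresolution A U) (Q : ModuleCat.{u} A)
    [Module.Injective A Q] {m : ℕ} (hA : Coacyclic A U m) (hQ : Acyclic A B U Q (m + 1)) :
    Acyclic A B U Q m := by
  have h : K.IsHomAcyclic Q := K.isHomAcyclic_of_injective Q
  have hC : LocAdd A U (relSyzygy A U Q (m + 1)) :=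
    (h.relSyzygy (m + 1)).locAdd hB (acyclic_relSyzygy hB h (m + 1) (m + 1) 0 rfl hQ)
  -- Extending the identity of the syzygy `m + 1` splits the cover of the syzygy `m`, which thereby
  -- becomes a summand of a direct sum of copies of `U`.
  obtain ⟨g, hg⟩ := exists_extension_relSyzygy h (fun i => (hP i).2) m _ (hC.coacyclic hA)
    (hC.isHomAcyclic hP hU) LinearMap.id
  obtain ⟨s, hs⟩ := exists_section_of_retraction (h.relSyzygy m).evalSum_surjective g hg
  exact acyclic_of_relSyzygy hB h m 0
    (((locAdd_finsupp _).acyclic hB 0).of_retract s _ hs)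

theorem Coacyclic.le_of_finite (K : AddCoresolution A U) {n m : ℕ} (hA : Coacyclic A U n)
    (hm : Coacyclic B U m) : Coacyclic B U n := by
  obtain ⟨Q, hQ, hQ'⟩ := exists_injective_cogenerator A
  rcases le_total m n with hmn | hmn
  · exact hm.mono hmn
  · refine Acyclic.coacyclic (A := A) hQ' ?_
    -- The descent from `m` stops at `n`, because a step to `k` needs `id_A(U) ≤ k`.
    exact Nat.decreasingInduction' (P := fun m => Acyclic A B U Q m)
      (fun k _ hk h => acyclic_pred_of_injective hB hP hU K Q (hA.mono hk) h) hmn hm.acyclic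

end Syzygy

/-! ### The duality `Hom_A(-, U)` between `A`-modules and `B`-modules -/

section Duality

variable {A : Type u} (B : Type u) [Ring A] [Ring B] {U : Type u} [AddCommGroup U] [Module A U]
  [Module B U] [SMulCommClass A B U] [SMulCommClass B A U]
  {X Y : Type u} [AddCommGroup X] [Module A X] [AddCommGroup Y] [Module A Y]

/-- Precomposition as a map of `B`-modules. -/
def precomp (a : X →ₗ[A] Y) : (Y →ₗ[A] U) →ₗ[B] (X →ₗ[A] U) where
  toFun f := f ∘ₗ a
  map_add' _ _ := rfl
  map_smul' _ _ := rfl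

/-- Evaluation as a map of `B`-modules. -/
def evalAt (x : X) : (X →ₗ[A] U) →ₗ[B] U where
  toFun f := f x
  map_add' _ _ := rfl
  map_smul' _ _ := rfl

variable (A U) in
/-- The canonical map from `X` to its bidual is bijective. -/
def IsReflexive (X : Type u) [AddCommGroup X] [Module A X] : Prop :=
  (∀ x : X, (∀ f : X →ₗ[A] U, f x = 0) → x = 0) ∧
    ∀ φ : (X →ₗ[A] U) →ₗ[B] U, ∃ x : X, evalAt B x = φ

variable {B}

theorem isReflexive_of_retractPow (hB : Function.Bijective (Module.toModuleEnd A (S := B) U))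
    (h : RetractPow A U X) : IsReflexive A B U X := by
  obtain ⟨k, i, r, hr⟩ := h
  have hr' : ∀ x, r (i x) = x := LinearMap.congr_fun hr
  refine ⟨fun x hx => ?_, fun φ => ?_⟩
  · have : i x = 0 := funext fun j => hx (LinearMap.proj j ∘ₗ i)
    rw [← hr' x, this, map_zero]
  · refine ⟨r fun j => φ (LinearMap.proj j ∘ₗ i), LinearMap.ext fun f => ?_⟩
    obtain ⟨b, hb⟩ := exists_rowMap_eq hB (f ∘ₗ r)
    have hf : f = ∑ j, b j • (LinearMap.proj j ∘ₗ i) := by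
      refine LinearMap.ext fun x => ?_
      have := LinearMap.congr_fun hb (i x)
      rw [LinearMap.comp_apply, hr', rowMap_apply] at this
      rw [← this]
      simp [LinearMap.sum_apply]
    change (f ∘ₗ r) (fun j => φ (LinearMap.proj j ∘ₗ i)) = φ f
    rw [← hb, rowMap_apply]
    conv_rhs => rw [hf]
    simp

omit [SMulCommClass B A U] in
theorem isReflexive_of_retractPow_self
    (hA : Function.Bijective (Module.toModuleEnd B (S := A) U))
    (h : RetractPow A A X) : IsReflexive A B U X := by
  obtain ⟨k, i, r, hr⟩ := h
  have hr' : ∀ x, r (i x) = x := LinearMap.congr_fun hr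
  refine ⟨fun x hx => ?_, fun φ => ?_⟩
  · have : i x = 0 := funext fun j => hA.1 (by
      rw [Pi.zero_apply, map_zero]
      exact LinearMap.ext fun u =>
        hx (LinearMap.toSpanSingleton A U u ∘ₗ LinearMap.proj (R := A) (φ := fun _ => A) j ∘ₗ i))
    rw [← hr' x, this, map_zero]
  -- Each coordinate of `φ` is a `B`-endomorphism of `U`, hence multiplication by an element of `A`.
  · let c : Fin k → U →ₗ[B] U := fun j =>
      { toFun := fun u => φ (LinearMap.toSpanSingleton A U u ∘ₗ LinearMap.proj j ∘ₗ i)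
        map_add' := fun u v => by
          rw [← map_add]
          congr 1
          ext x
          simp
        map_smul' := fun b u => by
          rw [RingHom.id_apply, ← map_smul]
          exact congrArg φ (LinearMap.ext fun x => smul_comm (i x j) b u) }
    choose a ha using fun j => hA.2 (c j)
    refine ⟨r a, LinearMap.ext fun f => ?_⟩
    have hf : f = ∑ j, LinearMap.toSpanSingleton A U (f (r (Pi.single j 1))) ∘ₗ
        LinearMap.proj j ∘ₗ i := by
      refine LinearMap.ext fun x => ?_
      conv_lhs => rw [← hr' x, pi_eq_sum_univ' (i x)]
      simp only [map_sum, LinearMap.sum_apply, LinearMap.comp_apply, map_smul,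
        LinearMap.toSpanSingleton_apply, LinearMap.proj_apply]
    change f (r a) = φ f
    conv_rhs => rw [hf, map_sum]
    conv_lhs => rw [pi_eq_sum_univ' a]
    simp only [map_sum, map_smul]
    refine Finset.sum_congr rfl fun j _ => ?_
    have h1 := LinearMap.congr_fun (ha j) (f (r (Pi.single j 1)))
    change a j • f (r (Pi.single j 1)) = _ at h1
    refine Eq.trans ?_ h1
    congr 3

/-- A power of `B` as the module of maps `U ^ k → U`. -/
noncomputable def rowEquiv (hB : Function.Bijective (Module.toModuleEnd A (S := B) U)) (k : ℕ) :
    (Fin k → B) ≃ₗ[B] ((Fin k → U) →ₗ[A] U) :=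
  LinearEquiv.ofBijective
    { toFun := rowMap A U
      map_add' := fun b c => LinearMap.ext fun x => by
        simp [add_smul, Finset.sum_add_distrib]
      map_smul' := fun b c => LinearMap.ext fun x => by
        simp [mul_smul, Finset.smul_sum] }
    ⟨by
      rw [← LinearMap.ker_eq_bot, LinearMap.ker_eq_bot']
      exact fun b hb => rowMap_injective hB hb, fun f => exists_rowMap_eq hB f⟩

variable (A B U) in
/-- A power of `U` as the module of maps `A ^ k → U`. -/
def columnEquiv (k : ℕ) : (Fin k → U) ≃ₗ[B] ((Fin k → A) →ₗ[A] U) where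
  toFun x := Fintype.linearCombination A x
  map_add' x y := LinearMap.ext fun a => by
    simp [Fintype.linearCombination_apply, Finset.sum_add_distrib]
  map_smul' b x := by
    refine LinearMap.ext fun y => ?_
    simp only [Fintype.linearCombination_apply, Pi.smul_apply, LinearMap.smul_apply,
      Finset.smul_sum, RingHom.id_apply]
    exact Finset.sum_congr rfl fun j _ => smul_comm _ _ _
  invFun f j := f (Pi.single j 1)
  left_inv x := by ext j; simp
  right_inv f := by
    refine LinearMap.pi_ext' fun j => LinearMap.ext_ring ?_
    simp

omit [SMulCommClass B A U] in
theorem RetractPow.precomp_of_equiv {V W : Type u} [AddCommGroup V] [Module A V] [AddCommGroup W]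
    [Module B W] (e : ∀ k : ℕ, (Fin k → W) ≃ₗ[B] ((Fin k → V) →ₗ[A] U)) (h : RetractPow A V X) :
    RetractPow B W (X →ₗ[A] U) := by
  obtain ⟨k, i, r, hr⟩ := h
  refine ⟨k, (e k).symm.toLinearMap ∘ₗ precomp B r, precomp B i ∘ₗ (e k).toLinearMap, ?_⟩
  refine LinearMap.ext fun f => ?_
  simp only [LinearMap.comp_apply, LinearEquiv.coe_coe, LinearEquiv.apply_symm_apply]
  change (f ∘ₗ r) ∘ₗ i = f
  rw [LinearMap.comp_assoc, hr, LinearMap.comp_id]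

/-! ### `U` over `B`: projective resolution, self-orthogonality, endomorphism ring -/

section Coresolution

variable (hB : Function.Bijective (Module.toModuleEnd A (S := B) U)) (K : AddCoresolution A U)

theorem AddCoresolution.retractPow_X (i : ℕ) : RetractPow A U (K.X i) := by
  obtain ⟨k, hk⟩ := K.mem i
  exact retractPow_of_isSummand hk

theorem AddCoresolution.map_η (a : A) {N : Type u} [AddCommGroup N] [Module A N]
    (f : K.X 0 →ₗ[A] N) : f (K.η a) = a • f (K.η 1) := by
  rw [← map_smul, ← map_smul, smul_eq_mul, mul_one]

variable (B) in
/-- The resolution `Hom_A(K, U)` of the `B`-module `U`. -/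
def AddCoresolution.dual : LeftResolution (ModuleCat.of B U) where
  X i := ModuleCat.of B (K.X i →ₗ[A] U)
  d i := precomp B (K.d i)
  ε := evalAt B (K.η 1)
  surjective u := by
    obtain ⟨g, hg⟩ := K.hom_surjective (LinearMap.toSpanSingleton A U u)
    exact ⟨g, (LinearMap.congr_fun hg (1 : A)).trans (one_smul A u)⟩
  exact_zero f := by
    refine Iff.trans ?_ (K.hom_exact_zero f)
    exact ⟨fun h => LinearMap.ext_ring h, fun h => LinearMap.congr_fun h (1 : A)⟩
  exact_succ i := K.hom_exact_succ i

include hB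

theorem AddCoresolution.dual_finite_projective (i : ℕ) :
    Module.Finite B ((K.dual B).X i) ∧ Module.Projective B ((K.dual B).X i) := by
  have h : RetractPow B B (K.X i →ₗ[A] U) :=
    (K.retractPow_X i).precomp_of_equiv (rowEquiv hB)
  exact ⟨h.finite, h.projective⟩

/-- The terms of `K` are reflexive, so the double dual of `K` is the exact sequence `K`. -/
theorem AddCoresolution.dual_isHomAcyclic : (K.dual B).IsHomAcyclic U := by
  intro i φ hφ
  obtain ⟨x, rfl⟩ := (isReflexive_of_retractPow hB (K.retractPow_X (i + 1))).2 φ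
  have hx : K.d (i + 1) x = 0 :=
    (isReflexive_of_retractPow hB (K.retractPow_X (i + 2))).1 _ fun f => LinearMap.congr_fun hφ f
  obtain ⟨y, rfl⟩ := (K.exact_succ i x).1 hx
  exact ⟨evalAt B y, rfl⟩

/-- An endomorphism `θ` composed with evaluation at `K.η 1` is a point of the bidual of `U₀`, hence
of `U₀`; it is killed by `K.d 0`, so it comes from `A`. -/
theorem AddCoresolution.toModuleEnd_bijective (K : AddCoresolution A U) :
    Function.Bijective (Module.toModuleEnd B (S := A) U) := by
  refine ⟨?_, fun θ => ?_⟩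
  · rw [injective_iff_map_eq_zero]
    intro a ha
    refine K.injective ((?_ : K.η a = 0).trans (map_zero K.η).symm)
    refine (isReflexive_of_retractPow hB (K.retractPow_X 0)).1 _ fun f => ?_
    rw [K.map_η]
    exact LinearMap.congr_fun ha (f (K.η 1))
  · obtain ⟨x, hx⟩ := (isReflexive_of_retractPow hB (K.retractPow_X 0)).2
      (θ ∘ₗ evalAt B (K.η 1))
    have hx0 : K.d 0 x = 0 := by
      refine (isReflexive_of_retractPow hB (K.retractPow_X 1)).1 _ fun g => ?_
      refine (LinearMap.congr_fun hx (g ∘ₗ K.d 0)).trans ?_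
      change θ (g (K.d 0 (K.η 1))) = 0
      rw [K.exact_zero.apply_apply_eq_zero, map_zero, map_zero]
    obtain ⟨a, rfl⟩ := (K.exact_zero x).1 hx0
    refine ⟨a, LinearMap.ext fun u => ?_⟩
    obtain ⟨f, rfl⟩ := (K.dual B).surjective u
    exact (K.map_η a f).symm.trans (LinearMap.congr_fun hx f)

end Coresolution

/-- The coresolution `Hom_A(P, U)` of `B`. -/
def LeftResolution.dual (hB : Function.Bijective (Module.toModuleEnd A (S := B) U))
    (hA : Function.Bijective (Module.toModuleEnd B (S := A) U))
    (P : LeftResolution (ModuleCat.of A U))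
    (hP : ∀ i, Module.Finite A (P.X i) ∧ Module.Projective A (P.X i)) (hU : P.IsHomAcyclic U) :
    AddCoresolution B U :=
  have hret : ∀ i, RetractPow A A (P.X i) := fun i =>
    have := (hP i).1
    have := (hP i).2
    retractPow_self_of_projective _
  have hrefl : ∀ i, IsReflexive A B U (P.X i) := fun i => isReflexive_of_retractPow_self hA (hret i)
  -- Such maps descend to endomorphisms of `U`, which are elements of `B`.
  have hε : ∀ f : P.X 0 →ₗ[A] U, f ∘ₗ P.d 0 = 0 → ∃ b : B, b • P.ε = f := fun f hf => by
    obtain ⟨g, rfl⟩ := exists_desc_of_exact P.surjective P.exact_zero f hf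
    obtain ⟨b, rfl⟩ := hB.2 g
    exact ⟨b, rfl⟩
  { X := fun i => ModuleCat.of B (P.X i →ₗ[A] U)
    η := LinearMap.toSpanSingleton B (P.X 0 →ₗ[A] U) P.ε
    d := fun i => precomp B (P.d i)
    mem := fun i => by
      obtain ⟨k, i', r, hr⟩ := (hret i).precomp_of_equiv (columnEquiv A B U)
      exact ⟨k, isSummand_of_retract i' r hr⟩
    injective := by
      rw [← LinearMap.ker_eq_bot, LinearMap.ker_eq_bot']
      intro b hb
      refine hB.1 ((LinearMap.ext fun u => ?_ : _ = (0 : U →ₗ[A] U)).trans (map_zero _).symm)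
      obtain ⟨x, rfl⟩ := P.surjective u
      exact LinearMap.congr_fun hb x
    exact_zero := fun f => by
      refine ⟨fun hf => hε f hf, ?_⟩
      rintro ⟨b, rfl⟩
      refine LinearMap.ext fun x => ?_
      change b • P.ε (P.d 0 x) = 0
      rw [P.exact_zero.apply_apply_eq_zero, smul_zero]
    exact_succ := fun i f => by
      refine ⟨fun hf => hU i f hf, ?_⟩
      rintro ⟨g, rfl⟩
      change (g ∘ₗ P.d i) ∘ₗ P.d (i + 1) = 0
      rw [LinearMap.comp_assoc, P.comp_eq_zero, LinearMap.comp_zero]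
    hom_surjective := fun g => by
      obtain ⟨x, hx⟩ := P.surjective (g 1)
      refine ⟨evalAt B x, LinearMap.ext_ring ?_⟩
      change (1 : B) • P.ε x = g 1
      rw [one_smul, hx]
    hom_exact_zero := fun ψ => by
      refine ⟨fun h => ?_, ?_⟩
      · obtain ⟨x, rfl⟩ := (hrefl 0).2 ψ
        have hx : P.ε x = 0 := by
          have : (1 : B) • P.ε x = 0 := LinearMap.congr_fun h 1
          rwa [one_smul] at this
        obtain ⟨y, rfl⟩ := (P.exact_zero x).1 hx
        exact ⟨evalAt B y, rfl⟩
      · rintro ⟨χ, rfl⟩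
        refine LinearMap.ext_ring ?_
        change χ (((1 : B) • P.ε) ∘ₗ P.d 0) = 0
        rw [one_smul, P.exact_zero.linearMap_comp_eq_zero, map_zero]
    hom_exact_succ := fun i ψ => by
      refine ⟨fun h => ?_, ?_⟩
      · obtain ⟨x, rfl⟩ := (hrefl (i + 1)).2 ψ
        have hx : P.d i x = 0 := (hrefl i).1 _ fun f => LinearMap.congr_fun h f
        obtain ⟨y, rfl⟩ := (P.exact_succ i x).1 hx
        exact ⟨evalAt B y, rfl⟩
      · rintro ⟨χ, rfl⟩
        refine LinearMap.ext fun f => ?_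
        change χ ((f ∘ₗ P.d i) ∘ₗ P.d (i + 1)) = 0
        rw [LinearMap.comp_assoc, P.comp_eq_zero, LinearMap.comp_zero, map_zero] }

/-- For a generalized tilting module over noetherian rings, finite injective dimensions on both
sides agree. -/
theorem coacyclic_iff_of_finite [IsNoetherianRing A] [IsNoetherianRing B] [Module.Finite A U]
    (hB : Function.Bijective (Module.toModuleEnd A (S := B) U)) (K : AddCoresolution A U)
    {P : LeftResolution (ModuleCat.of A U)}
    (hP : ∀ i, Module.Finite A (P.X i) ∧ Module.Projective A (P.X i)) (hU : P.IsHomAcyclic U)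
    {n m : ℕ} (hn : Coacyclic A U n) (hm : Coacyclic B U m) (j : ℕ) :
    Coacyclic A U j ↔ Coacyclic B U j := by
  have hA := K.toModuleEnd_bijective hB
  have hP' := K.dual_finite_projective hB
  have : Module.Finite B U := by
    have := (hP' 0).1
    exact Module.Finite.of_surjective (K.dual B).ε (K.dual B).surjective
  -- The second half exchanges `A` and `B`, with `K.dual` as resolution and `P.dual` as
  -- coresolution.
  exact ⟨fun h => h.le_of_finite hB hP hU K hm, fun h =>
    h.le_of_finite hA hP' (K.dual_isHomAcyclic hB) (P.dual hB hA hP hU) hn⟩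

end Duality

theorem apply_dualMap_single {S : Type u} [Ring S] {M : Type u} [AddCommGroup M] [Module S M]
    {k l : ℕ} (d : (Fin l → Sᵐᵒᵖ) →ₗ[Sᵐᵒᵖ] (Fin k → Sᵐᵒᵖ)) (g : (Fin l → S) →ₗ[S] M) (i : Fin k) :
    g (dualMap S S d (Pi.single i 1)) =
      ∑ j, (d (Pi.single j 1) i).unop • g (Pi.single j 1) := by
  have : dualMap S S d (Pi.single i 1) =
      ∑ j, (d (Pi.single j 1) i).unop • Pi.single j (1 : S) := by
    funext j
    rw [dualMap_apply, Finset.sum_apply, Finset.sum_eq_single i, Finset.sum_eq_single j]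
    · simp [MulOpposite.smul_eq_mul_unop]
    · intro t _ ht
      simp [ht.symm]
    · simp
    · intro t _ ht
      simp [ht]
    · simp
  rw [this, map_sum]
  simp only [map_smul]

/-! ### The module `Hom_R(U, Q)` -/

section Star

variable {R S : Type u} [Ring R] [Ring S] {U Q : Type u} [AddCommGroup U] [AddCommGroup Q]
  [Module R U] [Module Sᵐᵒᵖ U] [SMulCommClass Sᵐᵒᵖ R U] [Module R Q]

/-- An element of `Hom_R(U, Q)` as a map. -/
def starToHom : star R S U Q →+ (U →ₗ[R] Q) := AddMonoidHom.id _

theorem starToHom_smul (s : S) (f : star R S U Q) (x : U) :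
    starToHom (s • f) x = starToHom f (MulOpposite.op s • x) := rfl

/-- The map `U ^ k → Q` that corresponds to a map `S ^ k → Hom_R(U, Q)`. -/
def uncurryStar {k : ℕ} (g : (Fin k → S) →ₗ[S] star R S U Q) : (Fin k → U) →ₗ[R] Q :=
  ∑ j, starToHom (g (Pi.single j 1)) ∘ₗ LinearMap.proj j

theorem uncurryStar_apply {k : ℕ} (g : (Fin k → S) →ₗ[S] star R S U Q) (x : Fin k → U) :
    uncurryStar g x = ∑ j, starToHom (g (Pi.single j 1)) (x j) := by
  simp [uncurryStar, LinearMap.sum_apply]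

theorem uncurryStar_bijective (k : ℕ) :
    Function.Bijective (uncurryStar : ((Fin k → S) →ₗ[S] star R S U Q) → _) := by
  refine ⟨fun g g' h => LinearMap.pi_ext' fun j => LinearMap.ext_ring ?_, fun f => ?_⟩
  · refine LinearMap.ext fun x => ?_
    have := LinearMap.congr_fun h (Pi.single j x)
    simp only [uncurryStar_apply] at this
    rw [Finset.sum_eq_single j (fun i _ hi => by simp [hi]) (by simp),
      Finset.sum_eq_single j (fun i _ hi => by simp [hi]) (by simp), Pi.single_eq_same] at this
    exact this
  · let c : Fin k → star R S U Q := fun j => f ∘ₗ LinearMap.single R (fun _ => U) j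
    refine ⟨Fintype.linearCombination S c, LinearMap.pi_ext' fun j => LinearMap.ext fun x => ?_⟩
    rw [LinearMap.comp_apply, uncurryStar_apply, Finset.sum_eq_single j]
    · simp only [Fintype.linearCombination_apply_single, one_smul, LinearMap.coe_single,
        Pi.single_eq_same]
      rfl
    · intro i _ hi
      simp [hi]
    · simp

theorem uncurryStar_comp {k l : ℕ} (d : (Fin l → Sᵐᵒᵖ) →ₗ[Sᵐᵒᵖ] (Fin k → Sᵐᵒᵖ))
    (g : (Fin l → S) →ₗ[S] star R S U Q) :
    uncurryStar g ∘ₗ dualMap R U d = uncurryStar (g ∘ₗ dualMap S S d) := by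
  refine LinearMap.ext fun x => ?_
  rw [LinearMap.comp_apply, uncurryStar_apply, uncurryStar_apply]
  simp only [LinearMap.comp_apply, apply_dualMap_single, map_sum, LinearMap.sum_apply, starToHom_smul,
    MulOpposite.op_unop, dualMap_apply]
  exact Finset.sum_comm

theorem uncurryStar_zero (k : ℕ) :
    uncurryStar (0 : (Fin k → S) →ₗ[S] star R S U Q) = 0 := by
  refine LinearMap.ext fun x => ?_
  simp [uncurryStar_apply]

/-- The natural isomorphism `Hom_S(S ^ k, *Q) = Hom_R(U ^ k, Q)` identifies the two complexes. -/
theorem acyclic_star_iff (m : ℕ) :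
    Acyclic S Sᵐᵒᵖ S (star R S U Q) m ↔ Acyclic R Sᵐᵒᵖ U Q m := by
  refine forall_congr' fun F => ⟨fun h f hf => ?_, fun h f hf => ?_⟩
  · obtain ⟨f, rfl⟩ := (uncurryStar_bijective (S := S) _).2 f
    obtain ⟨g, rfl⟩ := h f ((uncurryStar_bijective _).1 (by
      rw [← uncurryStar_comp, hf, uncurryStar_zero]))
    exact ⟨uncurryStar g, uncurryStar_comp _ g⟩
  · obtain ⟨g, hg⟩ := h (uncurryStar f) (by rw [uncurryStar_comp, hf, uncurryStar_zero])
    obtain ⟨g, rfl⟩ := (uncurryStar_bijective (S := S) _).2 g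
    exact ⟨g, (uncurryStar_bijective _).1 (by rw [← uncurryStar_comp, hg])⟩

end Star

/-! ### Flatness and character modules -/

section Character

variable (S : Type u) [Ring S] (M : Type u) [AddCommGroup M] [Module S M]

/-- The character module of a left `S`-module, a right `S`-module. -/
def CharDual : Type u := CharacterModule M

instance : AddCommGroup (CharDual M) := inferInstanceAs (AddCommGroup (CharacterModule M))

instance : FunLike (CharDual M) M (AddCircle (1 : ℚ)) :=
  inferInstanceAs (FunLike (CharacterModule M) M _)

instance : AddMonoidHomClass (CharDual M) M (AddCircle (1 : ℚ)) :=
  inferInstanceAs (AddMonoidHomClass (M →+ AddCircle (1 : ℚ)) M _)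

variable {M}

theorem CharDual.ext {c c' : CharDual M} (h : ∀ x, c x = c' x) : c = c' := DFunLike.ext _ _ h

instance : Module Sᵐᵒᵖ (CharDual M) where
  smul s c := AddMonoidHom.comp (c : M →+ AddCircle (1 : ℚ)) (DistribSMul.toAddMonoidHom M s.unop)
  one_smul c := CharDual.ext fun x => congrArg c (one_smul S x)
  mul_smul s t c := CharDual.ext fun x => congrArg c (mul_smul t.unop s.unop x)
  smul_zero _ := rfl
  smul_add _ _ _ := rfl
  add_smul s t c := CharDual.ext fun x =>
    (congrArg c (add_smul s.unop t.unop x)).trans (map_add c _ _)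
  zero_smul c := CharDual.ext fun x => (congrArg c (zero_smul S x)).trans (map_zero c)

variable {S}

theorem exists_character_extension {G H : Type u} [AddCommGroup G] [AddCommGroup H] (f : G →+ H)
    (hf : Function.Injective f) (c : G →+ AddCircle (1 : ℚ)) :
    ∃ c' : H →+ AddCircle (1 : ℚ), ∀ x, c' (f x) = c x := by
  obtain ⟨c', hc'⟩ := CharacterModule.dual_surjective_of_injective f.toIntLinearMap hf c
  exact ⟨c', fun x => DFunLike.congr_fun hc' x⟩

/-! ### Adjunction between tensor products and character modules -/

section Tensor

variable {N N' : Type u} [AddCommGroup N] [Module Sᵐᵒᵖ N] [AddCommGroup N'] [Module Sᵐᵒᵖ N']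

/-- The class of `n ⊗ m`. -/
def BalancedTensor.tmul (n : N) (m : M) : BalancedTensor S N M :=
  QuotientAddGroup.mk' (balancingSubgroup S N M) (n ⊗ₜ[ℤ] m)

theorem BalancedTensor.smul_tmul (s : S) (n : N) (m : M) :
    BalancedTensor.tmul (MulOpposite.op s • n) m = BalancedTensor.tmul (S := S) n (s • m) := by
  refine (QuotientAddGroup.eq_iff_sub_mem).2 ?_
  exact AddSubgroup.subset_closure ⟨n, s, m, rfl⟩

theorem BalancedTensor.hom_ext {G : Type*} [AddCommGroup G] {c c' : BalancedTensor S N M →+ G}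
    (h : ∀ n m, c (BalancedTensor.tmul n m) = c' (BalancedTensor.tmul n m)) : c = c' := by
  refine QuotientAddGroup.addMonoidHom_ext _ (AddMonoidHom.ext fun t => ?_)
  induction t using TensorProduct.induction_on with
  | zero => rw [map_zero, map_zero]
  | tmul n m => exact h n m
  | add t t' ht ht' => rw [map_add, map_add, ht, ht']

/-- The character of `N ⊗ M` defined by a map from `N` to the character module of `M`. -/
def BalancedTensor.uncurry (g : N →ₗ[Sᵐᵒᵖ] CharDual M) :
    BalancedTensor S N M →+ AddCircle (1 : ℚ) :=
  QuotientAddGroup.lift (balancingSubgroup S N M)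
    (TensorProduct.liftAddHom
      { toFun := fun n => (g n : M →+ AddCircle (1 : ℚ))
        map_zero' := map_zero g
        map_add' := fun n n' => map_add g n n' }
      fun r n m => by
        change g (r • n) m = g n (r • m)
        rw [map_zsmul, map_zsmul]
        rfl)
    (by
      rw [balancingSubgroup, AddSubgroup.closure_le]
      rintro _ ⟨n, s, m, rfl⟩
      rw [SetLike.mem_coe, AddMonoidHom.mem_ker, map_sub, sub_eq_zero]
      change g (MulOpposite.op s • n) m = g n (s • m)
      rw [map_smul]
      rfl)

/-- The map to the character module defined by a character of `N ⊗ M`. -/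
def BalancedTensor.curry (c : BalancedTensor S N M →+ AddCircle (1 : ℚ)) :
    N →ₗ[Sᵐᵒᵖ] CharDual M where
  toFun n :=
    ({ toFun := fun m => c (BalancedTensor.tmul n m)
       map_zero' := by simp [BalancedTensor.tmul]
       map_add' := fun m m' => by simp [BalancedTensor.tmul, TensorProduct.tmul_add] } :
      M →+ AddCircle (1 : ℚ))
  map_add' n n' := CharDual.ext fun m => by
    change c _ = c _ + c _
    simp [BalancedTensor.tmul, TensorProduct.add_tmul]
  map_smul' s n := CharDual.ext fun m => congrArg c (BalancedTensor.smul_tmul s.unop n m)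

end Tensor

/-- Lambek's criterion: `Hom(N, M*) = (N ⊗ M)*`, and `ℚ/ℤ` is an injective cogenerator of abelian
groups. -/
theorem isFlat_iff_injective_charDual (M : ModuleCat.{u} S) :
    IsFlat S M ↔ Module.Injective Sᵐᵒᵖ (CharDual M) := by
  refine ⟨fun h => ⟨fun X Y _ _ _ _ f hf g => ?_⟩, fun h N N' φ hφ => ?_⟩
  · obtain ⟨c, hc⟩ := exists_character_extension (BalancedTensor.map S f M)
      (h (ModuleCat.of Sᵐᵒᵖ X) (ModuleCat.of Sᵐᵒᵖ Y) f hf) (BalancedTensor.uncurry g)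
    exact ⟨BalancedTensor.curry c, fun x => CharDual.ext fun m => hc (BalancedTensor.tmul x m)⟩
  · refine (injective_iff_map_eq_zero _).2 fun t ht => ?_
    refine CharacterModule.eq_zero_of_character_apply fun c => ?_
    obtain ⟨g, hg⟩ := h.out φ hφ (BalancedTensor.curry c)
    have hc : (c : BalancedTensor S N M →+ AddCircle (1 : ℚ)) =
        (BalancedTensor.uncurry g).comp (BalancedTensor.map S φ M) := by
      refine BalancedTensor.hom_ext fun n m => ?_
      exact (DFunLike.congr_fun (hg n) m).symm
    exact (DFunLike.congr_fun hc t).trans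
      ((congrArg (BalancedTensor.uncurry g) ht).trans (map_zero _))

/-- The character of `Hom_S(S ^ k, M)` that corresponds to a map `(Sᵐᵒᵖ) ^ k → CharDual M`. -/
def rowCharacter {k : ℕ} (φ : (Fin k → Sᵐᵒᵖ) →ₗ[Sᵐᵒᵖ] CharDual M) :
    ((Fin k → S) →ₗ[S] M) →+ AddCircle (1 : ℚ) where
  toFun f := ∑ j, φ (Pi.single j 1) (f (Pi.single j 1))
  map_zero' := by simp
  map_add' f f' := by simp [Finset.sum_add_distrib]

theorem rowCharacter_apply {k : ℕ} (φ : (Fin k → Sᵐᵒᵖ) →ₗ[Sᵐᵒᵖ] CharDual M)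
    (f : (Fin k → S) →ₗ[S] M) :
    rowCharacter φ f = ∑ j, φ (Pi.single j 1) (f (Pi.single j 1)) := rfl

theorem rowCharacter_zero {k : ℕ} (f : (Fin k → S) →ₗ[S] M) :
    rowCharacter (0 : (Fin k → Sᵐᵒᵖ) →ₗ[Sᵐᵒᵖ] CharDual M) f = 0 :=
  (rowCharacter_apply _ f).trans (Finset.sum_eq_zero fun _ _ => rfl)

theorem rowCharacter_single {k : ℕ} (φ : (Fin k → Sᵐᵒᵖ) →ₗ[Sᵐᵒᵖ] CharDual M) (j : Fin k) (m : M) :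
    rowCharacter φ (LinearMap.toSpanSingleton S M m ∘ₗ LinearMap.proj j) =
      φ (Pi.single j 1) m := by
  rw [rowCharacter_apply, Finset.sum_eq_single j]
  · simp
  · intro i _ hi
    simp [hi.symm]
  · simp

theorem rowCharacter_injective {k : ℕ} {φ ψ : (Fin k → Sᵐᵒᵖ) →ₗ[Sᵐᵒᵖ] CharDual M}
    (h : ∀ f, rowCharacter φ f = rowCharacter ψ f) : φ = ψ := by
  refine LinearMap.pi_ext' fun j => LinearMap.ext_ring (CharDual.ext fun m => ?_)
  rw [LinearMap.comp_apply, LinearMap.comp_apply, LinearMap.coe_single,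
    ← rowCharacter_single, ← rowCharacter_single, h]

theorem exists_rowCharacter_eq {k : ℕ} (c : ((Fin k → S) →ₗ[S] M) →+ AddCircle (1 : ℚ)) :
    ∃ φ : (Fin k → Sᵐᵒᵖ) →ₗ[Sᵐᵒᵖ] CharDual M, ∀ f, rowCharacter φ f = c f := by
  let x : Fin k → CharDual M := fun j =>
    (AddMonoidHom.mk' (fun m => c (LinearMap.toSpanSingleton S M m ∘ₗ LinearMap.proj j))
      fun m m' => by
        rw [← map_add]
        congr 1
        ext
        simp : M →+ AddCircle (1 : ℚ))
  refine ⟨Fintype.linearCombination Sᵐᵒᵖ x, fun f => ?_⟩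
  rw [rowCharacter_apply]
  simp only [Fintype.linearCombination_apply_single, one_smul]
  change ∑ j, c (LinearMap.toSpanSingleton S M (f (Pi.single j 1)) ∘ₗ LinearMap.proj j) = c f
  rw [← map_sum]
  congr 1
  refine LinearMap.pi_ext' fun i => LinearMap.ext_ring ?_
  rw [LinearMap.comp_apply, LinearMap.sum_apply, Finset.sum_eq_single i]
  · simp
  · intro j _ hj
    simp [hj]
  · simp

theorem rowCharacter_comp {k l : ℕ} (d : (Fin l → Sᵐᵒᵖ) →ₗ[Sᵐᵒᵖ] (Fin k → Sᵐᵒᵖ))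
    (φ : (Fin k → Sᵐᵒᵖ) →ₗ[Sᵐᵒᵖ] CharDual M) (f : (Fin l → S) →ₗ[S] M) :
    rowCharacter φ (f ∘ₗ dualMap S S d) = rowCharacter (φ ∘ₗ d) f := by
  rw [rowCharacter_apply, rowCharacter_apply]
  have h : ∀ (j : Fin l) (m : M), (φ ∘ₗ d) (Pi.single j 1) m =
      ∑ i, φ (Pi.single i 1) ((d (Pi.single j 1) i).unop • m) := by
    intro j m
    have hd : d (Pi.single j 1) = ∑ i, d (Pi.single j 1) i • Pi.single i (1 : Sᵐᵒᵖ) := by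
      funext t
      simp [Pi.single_apply]
    have hφ : φ (d (Pi.single j 1)) = ∑ i, d (Pi.single j 1) i • φ (Pi.single i 1) := by
      conv_lhs => rw [hd, map_sum]
      simp only [map_smul]
    rw [LinearMap.comp_apply, hφ]
    let ev : CharDual M →+ AddCircle (1 : ℚ) := AddMonoidHom.mk' (fun c => c m) fun _ _ => rfl
    change ev _ = _
    rw [map_sum]
    rfl
  simp only [LinearMap.comp_apply (f := f), apply_dualMap_single, map_sum, h]
  exact Finset.sum_comm

/-- `rowCharacter` identifies `Hom(F, M*)` with the character dual of `F ⊗ M`, and taking characters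
preserves and reflects exactness. -/
theorem homExact_charDual_iff (F : FreeSeq Sᵐᵒᵖ) :
    HomExact (F.d 1) (F.d 0) (CharDual M) ↔
      HomExact (dualMap S S (F.d 0)) (dualMap S S (F.d 1)) M := by
  refine ⟨fun h f hf => ?_, fun h φ hφ => ?_⟩
  · let I : AddSubgroup ((Fin (F.k 1) → S) →ₗ[S] M) :=
      (AddMonoidHom.mk' (fun g : (Fin (F.k 2) → S) →ₗ[S] M => g ∘ₗ dualMap S S (F.d 1))
        fun _ _ => rfl).range
    suffices hfI : f ∈ I from hfI
    rw [← QuotientAddGroup.eq_zero_iff]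
    refine CharacterModule.eq_zero_of_character_apply fun c => ?_
    obtain ⟨φ, hφ⟩ := exists_rowCharacter_eq
      ((c : _ ⧸ I →+ AddCircle (1 : ℚ)).comp (QuotientAddGroup.mk' I))
    obtain ⟨γ, rfl⟩ := h φ (rowCharacter_injective fun g => by
      rw [← rowCharacter_comp, hφ, rowCharacter_zero]
      have : (QuotientAddGroup.mk' I) (g ∘ₗ dualMap S S (F.d 1)) = 0 :=
        (QuotientAddGroup.eq_zero_iff _).2 ⟨g, rfl⟩
      exact (congrArg c this).trans (map_zero c))
    refine (hφ f).symm.trans ?_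
    rw [← rowCharacter_comp, hf, map_zero]
  · let p : ((Fin (F.k 1) → S) →ₗ[S] M) →+ ((Fin (F.k 0) → S) →ₗ[S] M) :=
      AddMonoidHom.mk' (fun g => g ∘ₗ dualMap S S (F.d 0)) fun _ _ => rfl
    have hker : p.ker ≤ (rowCharacter φ).ker := by
      intro f hf
      obtain ⟨g, rfl⟩ := h f hf
      rw [AddMonoidHom.mem_ker, rowCharacter_comp, hφ, rowCharacter_zero]
    obtain ⟨c, hc⟩ := exists_character_extension (QuotientAddGroup.kerLift p)
      (QuotientAddGroup.kerLift_injective p) (QuotientAddGroup.lift p.ker (rowCharacter φ) hker)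
    obtain ⟨γ, hγ⟩ := exists_rowCharacter_eq c
    refine ⟨γ, rowCharacter_injective fun f => ?_⟩
    rw [← rowCharacter_comp, hγ]
    exact hc (QuotientAddGroup.mk' _ f)

theorem isFlat_iff_acyclic [IsNoetherianRing Sᵐᵒᵖ] (M : ModuleCat.{u} S) :
    IsFlat S M ↔ Acyclic S Sᵐᵒᵖ S M 0 := by
  rw [isFlat_iff_injective_charDual, ← coacyclic_zero_iff]
  exact forall_congr' fun F => homExact_charDual_iff F

end Character

/-! ### Finiteness of the dimensions -/

section Main

theorem injectiveDimension_eq_of_coacyclic_iff {A B : Type u} [Ring A] [Ring B]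
    [IsNoetherianRing A] [IsNoetherianRing B] (U : Type u) [AddCommGroup U] [Module A U]
    [Module B U] (h : ∀ j, Coacyclic A U j ↔ Coacyclic B U j) :
    injectiveDimension (ModuleCat.of A U) = injectiveDimension (ModuleCat.of B U) := by
  have key : ∀ j : ℕ, HasInjectiveDimensionLT (ModuleCat.of A U) j ↔
      HasInjectiveDimensionLT (ModuleCat.of B U) j := by
    intro j
    cases j with
    | zero =>
      -- The value `⊥` means `U = 0`, which does not depend on the ring of scalars.
      rw [hasInjectiveDimensionLT_zero_iff_isZero, hasInjectiveDimensionLT_zero_iff_isZero,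
        ModuleCat.isZero_iff_subsingleton, ModuleCat.isZero_iff_subsingleton]
    | succ j =>
      exact (coacyclic_iff_hasInjectiveDimensionLE j U).symm.trans
        ((h j).trans (coacyclic_iff_hasInjectiveDimensionLE j U))
  simp only [injectiveDimension, key]

theorem exists_coacyclic_of_injectiveDimension_ne_top {A : Type u} [Ring A] [IsNoetherianRing A]
    {U : Type u} [AddCommGroup U] [Module A U]
    (h : injectiveDimension (ModuleCat.of A U) ≠ ⊤) : ∃ m, Coacyclic A U m := by
  obtain ⟨m, hm⟩ := (injectiveDimension_ne_top_iff _).1 h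
  exact ⟨m, (coacyclic_iff_hasInjectiveDimensionLE m U).2 hm⟩

variable {S : Type u} [Ring S]

theorem toModuleEnd_self_bijective :
    Function.Bijective (Module.toModuleEnd S (S := Sᵐᵒᵖ) S) :=
  ⟨fun a b h => MulOpposite.unop_injective (by simpa using LinearMap.congr_fun h (1 : S)),
    fun f => ⟨MulOpposite.op (f 1), LinearMap.ext_ring (by simp)⟩⟩

theorem acyclic_of_projective (X : Type u) [AddCommGroup X] [Module S X]
    (_ : Module.Projective S X) : Acyclic S Sᵐᵒᵖ S X 0 :=
  (locAdd_of_projective X).acyclic toModuleEnd_self_bijective 0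

/-- The module `S` takes the place of `U`; as it is projective, all lifts along surjections exist.
-/
theorem flatDim_ne_top_iff [IsNoetherianRing Sᵐᵒᵖ] (M : ModuleCat.{u} S) :
    flatDim S M ≠ ⊤ ↔ ∃ m, Acyclic S Sᵐᵒᵖ S M m := by
  refine resolDim_ne_top_iff.trans (exists_congr fun m => ⟨fun h => ?_, fun h => ?_⟩)
  · exact acyclic_of_hasResolutionOfLength (fun X hX => (isFlat_iff_acyclic X).1 hX) m M h
  · exact exists_hasResolutionOfLength_of_acyclic (fun X hX => (isFlat_iff_acyclic X).2 hX)
      (fun I => acyclic_of_projective (I →₀ S) inferInstance) m M h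

theorem exists_acyclic_of_projectiveDimension_ne_top (M : ModuleCat.{u} S)
    (h : projectiveDimension M ≠ ⊤) : ∃ m, Acyclic S Sᵐᵒᵖ S M m := by
  obtain ⟨m, hm⟩ := (projectiveDimension_ne_top_iff _).1 h
  exact ⟨m, acyclic_of_hasProjectiveDimensionLE acyclic_of_projective m M hm⟩

end Main

end GenTilt

/-! ### The main theorem -/

open GenTilt in
theorem corollary2p12 (R S : Type u) [Ring R] [Ring S]
    [IsNoetherianRing R] [IsNoetherianRing Sᵐᵒᵖ]
    (U : Type u) [AddCommGroup U] [Module R U] [Module Sᵐᵒᵖ U] [SMulCommClass Sᵐᵒᵖ R U]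
    (hU : GenTilt.IsGeneralizedTilting R U) (hS : GenTilt.IsEndRing R U S)
    (Q : Type u) [AddCommGroup Q] [Module R Q]
    (hQ : Module.Injective R Q) (hQ' : IsCoseparator (ModuleCat.of R Q))
    (n : WithBot ℕ∞) (hn : n ≠ ⊤) (hid : injectiveDimension (ModuleCat.of R U) = n) :
    injectiveDimension (ModuleCat.of Sᵐᵒᵖ U) = n ↔
      (GenTilt.flatDim S (GenTilt.star R S U Q) ≠ ⊤ ∨
        projectiveDimension (GenTilt.star R S U Q) ≠ ⊤ ∨
        GenTilt.limDim R U (ModuleCat.of R Q) ≠ ⊤ ∨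
        GenTilt.addResolDim R U (ModuleCat.of R Q) ≠ ⊤) := by
  have := SMulCommClass.symm Sᵐᵒᵖ R U
  obtain ⟨P, hP⟩ := hU.genStar
  obtain ⟨K⟩ := hU.coresolution
  have hfin : Module.Finite R U := by
    have := (hP 0).1
    exact Module.Finite.of_surjective P.ε P.surjective
  have hPU : P.IsHomAcyclic U := fun i =>
    P.homExact_of_ext i (fun j => (hP j).2) fun j => hU.selforthogonal (j + 1) (Nat.le_add_left 1 j)
  have hB : Function.Bijective (Module.toModuleEnd R (S := Sᵐᵒᵖ) U) := hS
  obtain ⟨a, ha⟩ := exists_coacyclic_of_injectiveDimension_ne_top (hid ▸ hn)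
  constructor
  · intro h
    obtain ⟨m, hm⟩ := exists_coacyclic_of_injectiveDimension_ne_top (h ▸ hn)
    exact Or.inl ((flatDim_ne_top_iff _).2 ⟨m, (acyclic_star_iff m).2 hm.acyclic⟩)
  · intro h
    have hloc : (∃ m, HasResolutionOfLength (fun X => LocAdd R U X) (ModuleCat.of R Q) m) →
        ∃ m, Acyclic R Sᵐᵒᵖ U Q m := fun ⟨m, hm⟩ =>
      ⟨m, acyclic_of_hasResolutionOfLength_locAdd hB hP hPU m _ hm⟩
    -- Each alternative bounds the flat dimension of `*Q`, that is, the injective dimension of `U`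
    -- over `Sᵐᵒᵖ`.
    obtain ⟨m, hm⟩ : ∃ m, Acyclic R Sᵐᵒᵖ U Q m := by
      rcases h with h | h | h | h
      · obtain ⟨m, hm⟩ := (flatDim_ne_top_iff _).1 h
        exact ⟨m, (acyclic_star_iff m).1 hm⟩
      · obtain ⟨m, hm⟩ := exists_acyclic_of_projectiveDimension_ne_top _ h
        exact ⟨m, (acyclic_star_iff m).1 hm⟩
      · obtain ⟨m, hm⟩ := resolDim_ne_top_iff.1 h
        exact hloc ⟨m, hm.mono locAdd_of_memAddLim⟩
      · obtain ⟨m, hm⟩ := resolDim_ne_top_iff.1 h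
        exact hloc ⟨m, hm.mono locAdd_of_memBigAdd⟩
    rw [← hid]
    exact (injectiveDimension_eq_of_coacyclic_iff U
      (coacyclic_iff_of_finite hB K hP hPU ha (hm.coacyclic hQ'))).symm
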